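/- Let $n \ge 2$ and $K \ge 3$. Identify $\mathbb{C}^{n(n-1)/2}$ with the set of upper unitriangular complex $n\times n$ matrices $A$ (via the entries above the diagonal) and $\mathbb{C}^{n(n+1)/2}$ with the set of symmetric complex $n\times n$ matrices $Z$, and put $$M^-(A,Z)=\begin{bmatrix} I_n&0\\ Z&I_n\end{bmatrix}\begin{bmatrix}A^{-T}&0\\0&A\end{bmatrix},\qquad M^+(A,Z)=\begin{bmatrix} I_n&Z\\ 0&I_n\end{bmatrix}\begin{bmatrix}A^{-1}&0\\0&A^{T}\end{bmatrix}.$$ On $(\mathbb{C}^{n(n-1)/2}\times\mathbb{C}^{n(n+1)/2})^K$, whose points are written $((A_1,Z_1),\dots,(A_K,Z_K))$, let $\Psi_K = M^-(A_1,Z_1)M^+(A_2,Z_2)\cdots M^{\pm}(A_K,Z_K)$ (the signs alternate), let $\Phi_K$ be the last row of $\Psi_K$, and let $$S_K=\{Z_ie_n=0 \text{ for } 1\le i<K,\ \ A_je_n=e_n \text{ for } 1<j<K\},$$ where $e_n$ is the last standard basis vector of $\mathbb{C}^n$. Then $$\Phi_K:\ (\mathbb{C}^{n(n-1)/2}\times\mathbb{C}^{n(n+1)/2})^K\setminus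 S_K\ \longrightarrow\ \mathbb{C}^{2n}\setminus\{0\}$$ is a surjective stratified elliptic submersion. Here a holomorphic map $h:Z\to X$ of complex manifolds is a submersion if near every point of $Z$ it is equivalent, via a fiber preserving biholomorphic map, to a projection $U\times V\to U$ with $U\subset X$ open and $V$ open in some $\mathbb{C}^d$. A dominating fiber spray associated with a submersion $h: Z\to X$ is a triple $(E,p,s)$ of a holomorphic vector bundle $p:E\to Z$ and a holomorphic map $s:E\to Z$ such that for every $z\in Z$: $s(E_z)\subset h^{-1}(h(z))$, $s(0_z)=z$, and $Ds(0_z)$ maps $E_z\subset T_{0_z}E$ onto $\ker Dh(z)$. The submersion $h$ is stratified elliptic if there is a descending chain of closed complex subspaces $X=X_m\supset\cdots\supset X_0\supset X_{-1}=\emptyset$ such that each stratum $Y_k=X_k\setminus X_{k-1}$, $0\le k\le m$, is regular (a complex submanifold) and every point of $Y_k$ has an open neighborhood $U$ in $Y_k$ such that the restricted submersion $h:h^{-1}(U)\to U$ admits a dominating fiber spray. -/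

import Mathlib

open scoped Topology Matrix

/-! ### Stratified elliptic submersions

Source and target are open subsets `Z`, `X` of finite-dimensional complex normed spaces. The
strata and the pieces `Z|_U` of the source over open parts of strata are locally closed complex
submanifolds; a map on such a subset is holomorphic if it is locally the restriction of a
holomorphic map of the ambient space. -/

/-- `f : M → H` is holomorphic at `m`, where the complex structure of `M` is the one it inherits
from the ambient space `G` along the inclusion `j : M → G`: near `m`, `f` is the restriction of a
map that is holomorphic on a neighbourhood of `j m` in `G`. -/
def HolomorphicAlongAt {M G H : Type*} [TopologicalSpace M]
    [NormedAddCommGroup G] [NormedSpace ℂ G] [NormedAddCommGroup H] [NormedSpace ℂ H]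
    (j : M → G) (f : M → H) (m : M) : Prop :=
  ∃ g : G → H, AnalyticAt ℂ g (j m) ∧ ∀ᶠ y in 𝓝 m, f y = g (j y)

section Definitions

variable {E F : Type*} [NormedAddCommGroup E] [NormedSpace ℂ E]
  [NormedAddCommGroup F] [NormedSpace ℂ F]

/-- `h : Z → X` is a holomorphic submersion between the open sets `Z ⊆ E` and `X ⊆ F`: it is
holomorphic, and near each point of `Z` it is equivalent, via a fibre preserving biholomorphic
map `φ`, to a projection `U × V → U` with `U ⊆ X` open and `V` open in some `ℂᵈ`. -/
structure IsHolomorphicSubmersion (h : E → F) (Z : Set E) (X : Set F) : Prop where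
  isOpen_source : IsOpen Z
  isOpen_target : IsOpen X
  mapsTo : Set.MapsTo h Z X
  holomorphic : AnalyticOnNhd ℂ h Z
  locally_projection : ∀ z₀ ∈ Z, ∃ (d : ℕ) (φ : OpenPartialHomeomorph E (F × (Fin d → ℂ)))
    (U : Set F) (V : Set (Fin d → ℂ)),
      z₀ ∈ φ.source ∧ φ.source ⊆ Z ∧
      IsOpen U ∧ U ⊆ X ∧ IsOpen V ∧ φ.target = U ×ˢ V ∧
      AnalyticOnNhd ℂ φ φ.source ∧ AnalyticOnNhd ℂ φ.symm φ.target ∧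
      ∀ z ∈ φ.source, (φ z).1 = h z

/-- `A` is a closed (reduced) complex subspace of the open set `X`: near every point of `X`
it is the common zero set of finitely many holomorphic functions. -/
def IsClosedComplexSubspace (A X : Set F) : Prop :=
  A ⊆ X ∧ ∀ x ∈ X, ∃ (U : Set F) (r : ℕ) (f : F → Fin r → ℂ),
    IsOpen U ∧ x ∈ U ∧ U ⊆ X ∧ AnalyticOnNhd ℂ f U ∧ A ∩ U = {y ∈ U | f y = 0}

/-- `Y` is regular, i.e. a locally closed complex submanifold: near each of its points it is the
zero set of a holomorphic map to some `ℂᶜ` with surjective differential. -/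
def IsRegularSubspace (Y : Set F) : Prop :=
  ∀ y ∈ Y, ∃ (U : Set F) (c : ℕ) (f : F → Fin c → ℂ),
    IsOpen U ∧ y ∈ U ∧ AnalyticOnNhd ℂ f U ∧
    (∀ u ∈ U, Function.Surjective (fderiv ℂ f u)) ∧ Y ∩ U = {u ∈ U | f u = 0}

/-- A holomorphic vector bundle of rank `r` over the complex submanifold `W` of `E`, given by an
open cover of `W` with a cocycle of holomorphic transition functions. Its total space is
`B.toVectorBundleCore.TotalSpace`. -/
structure HolomorphicVectorBundle (W : Set E) (r : ℕ) (ι : Type*) extends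
    VectorBundleCore ℂ W (Fin r → ℂ) ι where
  holomorphic_coordChange : ∀ i j, ∀ z ∈ baseSet i ∩ baseSet j,
    HolomorphicAlongAt (fun w : W => (w : E)) (coordChange i j) z

/-- The data `(B, p, s)`, with `p` the bundle projection of `B`, form a dominating fibre spray
on `W ⊆ Z` associated with the submersion `h : Z → X`; here `W = Z ∩ h⁻¹(U)` is the part of the
source over some submanifold `U` of `X`, so that the fibre of `h` through `z ∈ W`, and hence the
vertical tangent space `ker Dh(z)`, are the same for `h` and for its restriction to `W`. -/
structure IsDominatingFiberSpray (h : E → F) (Z W : Set E) {r : ℕ} {ι : Type*}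
    (B : HolomorphicVectorBundle W r ι) (s : B.TotalSpace → E) : Prop where
  /-- `s` is holomorphic in every local trivialization of `B`. -/
  holomorphic : ∀ (i : ι) (z : W), z ∈ B.baseSet i → ∀ v : Fin r → ℂ,
    HolomorphicAlongAt (fun p : W × (Fin r → ℂ) => ((p.1 : E), p.2))
      (fun p => s ((B.localTriv i).toOpenPartialHomeomorph.symm p)) (z, v)
  /-- `s(E_z) ⊆ Z_{h(z)}` -/
  map_fiber : ∀ (z : W) (v : B.Fiber z), s ⟨z, v⟩ ∈ Z ∧ h (s ⟨z, v⟩) = h z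
  /-- `s(0_z) = z` -/
  map_zero : ∀ z : W, s ⟨z, 0⟩ = z
  /-- `Ds(0_z)` maps `E_z` onto the vertical tangent space at `z`. -/
  dominating : ∀ z : W,
    LinearMap.range (fderiv ℂ (fun v : Fin r → ℂ => s ⟨z, v⟩) 0).toLinearMap =
      LinearMap.ker (fderiv ℂ h z).toLinearMap

/-- The strata `Y_k = X_k \ X_{k-1}` of an increasing sequence of sets, with `X_{-1} = ∅`. -/
def stratum (Xs : ℕ → Set F) : ℕ → Set F
  | 0 => Xs 0
  | k + 1 => Xs (k + 1) \ Xs k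

/-- `h : Z → X` is a stratified elliptic submersion of `Z` onto `X`. -/
structure IsStratifiedEllipticSubmersion (h : E → F) (Z : Set E) (X : Set F) : Prop where
  submersion : IsHolomorphicSubmersion h Z X
  surjective : Set.SurjOn h Z X
  stratified : ∃ (m : ℕ) (Xs : ℕ → Set F),
    Xs m = X ∧ (∀ k < m, Xs k ⊆ Xs (k + 1)) ∧
    (∀ k ≤ m, IsClosedComplexSubspace (Xs k) X) ∧
    ∀ k ≤ m, IsRegularSubspace (stratum Xs k) ∧
      ∀ x ∈ stratum Xs k, ∃ U : Set F, IsOpen U ∧ x ∈ U ∧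
        ∃ (r : ℕ) (ι : Type) (B : HolomorphicVectorBundle (Z ∩ h ⁻¹' (stratum Xs k ∩ U)) r ι)
          (s : B.TotalSpace → E), IsDominatingFiberSpray h Z _ B s

end Definitions

/-! ### The map `Φ_K` -/

/-- `ℂ^{n(n-1)/2}`: the entries above the diagonal of an upper unitriangular matrix. -/
abbrev UnitriCoord (n : ℕ) : Type := {p : Fin n × Fin n // p.1 < p.2} → ℂ

/-- `ℂ^{n(n+1)/2}`: the entries of a symmetric matrix. -/
abbrev SymCoord (n : ℕ) : Type := Sym2 (Fin n) → ℂ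

/-- The space `(ℂ^{n(n-1)/2} × ℂ^{n(n+1)/2})^K`. -/
abbrev ParamSpace (n K : ℕ) : Type := Fin K → UnitriCoord n × SymCoord n

/-- The upper unitriangular matrix with the given entries above the diagonal. -/
def unitriMatrix {n : ℕ} (a : UnitriCoord n) : Matrix (Fin n) (Fin n) ℂ :=
  Matrix.of fun i j => if h : i < j then a ⟨(i, j), h⟩ else if i = j then 1 else 0

/-- The symmetric matrix with the given entries. -/
def symMatrix {n : ℕ} (z : SymCoord n) : Matrix (Fin n) (Fin n) ℂ :=
  Matrix.of fun i j => z s(i, j)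

/-- `M⁻(A, Z)` -/
noncomputable def elemMinus {n : ℕ} (A Z : Matrix (Fin n) (Fin n) ℂ) :
    Matrix (Fin n ⊕ Fin n) (Fin n ⊕ Fin n) ℂ :=
  Matrix.fromBlocks 1 0 Z 1 * Matrix.fromBlocks (A⁻¹)ᵀ 0 0 A

/-- `M⁺(A, Z)` -/
noncomputable def elemPlus {n : ℕ} (A Z : Matrix (Fin n) (Fin n) ℂ) :
    Matrix (Fin n ⊕ Fin n) (Fin n ⊕ Fin n) ℂ :=
  Matrix.fromBlocks 1 Z 0 1 * Matrix.fromBlocks A⁻¹ 0 0 Aᵀ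

/-- `Ψ_K = M⁻(A₁, Z₁) M⁺(A₂, Z₂) ⋯ M^±(A_K, Z_K)`; the factor with (zero-based) index `k` is of
type `M⁻` if `k` is even and of type `M⁺` if `k` is odd. -/
noncomputable def psiMap (n K : ℕ) (x : ParamSpace n K) :
    Matrix (Fin n ⊕ Fin n) (Fin n ⊕ Fin n) ℂ :=
  (List.ofFn fun k : Fin K =>
    if Even (k : ℕ) then elemMinus (unitriMatrix (x k).1) (symMatrix (x k).2)
    else elemPlus (unitriMatrix (x k).1) (symMatrix (x k).2)).prod

/-- The last standard basis vector `e_n` of `ℂⁿ`. -/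
def lastVec (n : ℕ) : Fin n → ℂ := fun i => if (i : ℕ) + 1 = n then 1 else 0

/-- `Φ_K = π_{2n} ∘ Ψ_K`, the last row `e_{2n}ᵀ Ψ_K` of `Ψ_K`. -/
noncomputable def phiMap (n K : ℕ) (x : ParamSpace n K) : Fin n ⊕ Fin n → ℂ :=
  Sum.elim 0 (lastVec n) ᵥ* psiMap n K x

/-- `S_K = {Z_i e_n = 0 for i < K, A_j e_n = e_n for 1 < j < K}` (with indices `1, …, K`; the
zero-based index `k` stands for `k + 1`). -/
def singSet (n K : ℕ) : Set (ParamSpace n K) :=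
  {x | (∀ k : Fin K, (k : ℕ) + 1 < K → symMatrix (x k).2 *ᵥ lastVec n = 0) ∧
    ∀ k : Fin K, 0 < (k : ℕ) → (k : ℕ) + 1 < K → unitriMatrix (x k).1 *ᵥ lastVec n = lastVec n}

/-! Two facts about the factors drive the proof. The factors of one sign form a group
(`elemMinus_mul`; exchanging the two halves of the coordinates turns one sign into the other). This
group is unitriangular for a suitable order of the 2n coordinates, and the two signs have opposite
orders (`isPivTri_elemMinus`, `pivRank_swap`).

Submersion. If the differential of Φ is not onto at x, some nonzero column c annihilates its image.
Varying one factor at a time and translating in its group shows that, at each junction of two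
consecutive factors, the partial row and the partial column are critical for the Lie algebras of
both signs. Since the row after one more factor still has last coordinate 1, this forces the row to
be the last basis vector and the column to be a multiple of it (`eq_single_of_isCritPair`). By
induction along the product all middle factors fix this vector on both sides and the first one fixes
it as a row. These are the equations of `singSet`.

Stratification. Order the coordinates so that the last factor is unitriangular. The strata consist
of the rows v whose first nonzero coordinate, the pivot d, is prescribed. The last factor does not
change the pivot, so the coordinate Q = `rowAt` (K-1) d of the row before it equals v d on the fibre
over v. Conversely, on the level set Q = v d, the last factor but one can be corrected, by the
opposite order, to clear the coordinates in front of d, and then the last factor can be corrected to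
produce v. The corrections divide only by v d and are trivial on the fibre. Hence `fiberRetract`
retracts the level set holomorphically onto the whole fibre of Φ.

Spray. Q is affine in each single parameter, so the Koszul fields ∂ⱼQ ∂ᵢ - ∂ᵢQ ∂ⱼ are complete with
explicit flows and preserve Q. They span the kernel of dQ wherever dQ is nonzero. Composing their
flows and then applying the retraction gives a dominating spray over the entire stratum
(`exists_spray_of_retraction`). The removed set fits in: points of a fibre outside `singSet` are not
critical for Q (`exists_diffAlong_ne_zero`), the flows preserve noncriticality, and the retraction
sends noncritical points outside `singSet` (`fiberRetract_notMem_singSet`). -/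

/-! ### Submersions -/

section Submersion

variable {E F : Type*} [NormedAddCommGroup E] [NormedSpace ℂ E]
  [NormedAddCommGroup F] [NormedSpace ℂ F]

open scoped ContDiff in
/-- A holomorphic map between open sets of finite-dimensional spaces whose differential is
everywhere onto is a holomorphic submersion. -/
theorem isHolomorphicSubmersion_of_surjective_fderiv [FiniteDimensional ℂ E]
    [FiniteDimensional ℂ F] {h : E → F} {Z : Set E} {X : Set F}
    (hZ : IsOpen Z) (hX : IsOpen X) (hmaps : Set.MapsTo h Z X) (hh : AnalyticOnNhd ℂ h Z)
    (hsurj : ∀ z ∈ Z, Function.Surjective (fderiv ℂ h z)) :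
    IsHolomorphicSubmersion h Z X := by
  refine ⟨hZ, hX, hmaps, hh, fun z₀ hz₀ => ?_⟩
  have : CompleteSpace E := FiniteDimensional.complete ℂ E
  have : CompleteSpace F := FiniteDimensional.complete ℂ F
  set L := fderiv ℂ h z₀ with hL
  obtain ⟨pr, hpr⟩ := L.ker_closedComplemented_of_finiteDimensional_range
  let d := Module.finrank ℂ L.ker
  let b : L.ker ≃L[ℂ] (Fin d → ℂ) :=
    ContinuousLinearEquiv.ofFinrankEq (by simp [d])
  -- Completing h by linear coordinates on the kernel of its differential makes the differential
  -- invertible, so the inverse function theorem supplies the chart.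
  let π : E →L[ℂ] (Fin d → ℂ) := (b : L.ker →L[ℂ] (Fin d → ℂ)).comp pr
  have hkerπ : π.ker = pr.ker := by
    ext x; simp [π]
  have hprsurj : Function.Surjective pr := fun y => ⟨y, hpr y⟩
  let T : E ≃L[ℂ] F × (Fin d → ℂ) :=
    ContinuousLinearMap.equivProdOfSurjectiveOfIsCompl L π
      (LinearMap.range_eq_top.2 (hsurj z₀ hz₀))
      (LinearMap.range_eq_top.2 (b.surjective.comp hprsurj))
      (by rw [hkerπ]; exact LinearMap.isCompl_of_proj hpr)
  let g : E → F × (Fin d → ℂ) := fun x => (h x, π x)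
  have hgan : ∀ z ∈ Z, AnalyticAt ℂ g z := fun z hz => AnalyticAt.prod (hh z hz) (π.analyticAt z)
  have hgd : HasFDerivAt g (T : E →L[ℂ] F × (Fin d → ℂ)) z₀ := by
    have h1 : HasFDerivAt g (L.prod π) z₀ :=
      ((hh z₀ hz₀).differentiableAt.hasFDerivAt).prodMk π.hasFDerivAt
    have h2 : (T : E →L[ℂ] F × (Fin d → ℂ)) = L.prod π := by ext x <;> rfl
    rw [h2]; exact h1
  have hgc : ContDiffAt ℂ ω g z₀ := (hgan z₀ hz₀).contDiffAt
  let φ₀ := hgc.toOpenPartialHomeomorph g hgd (by simp)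
  have hφ₀ : (φ₀ : E → F × (Fin d → ℂ)) = g := rfl
  have hmem : z₀ ∈ φ₀.source := hgc.mem_toOpenPartialHomeomorph_source hgd (by simp)
  have hmemt : g z₀ ∈ φ₀.target := hgc.image_mem_toOpenPartialHomeomorph_target hgd (by simp)
  have hsymm : AnalyticAt ℂ φ₀.symm (g z₀) := by
    have := hgc.to_localInverse hgd (by simp)
    exact this.analyticAt
  have hsz : φ₀.symm (g z₀) = z₀ := φ₀.left_inv hmem
  -- The chart has to be cut down to a product box that lies over X, comes from Z and carries a
  -- holomorphic inverse.
  have hN : {y | y ∈ φ₀.target ∧ AnalyticAt ℂ φ₀.symm y ∧ φ₀.symm y ∈ Z ∧ y.1 ∈ X} ∈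
      𝓝 (g z₀) := by
    have h1 : ∀ᶠ y in 𝓝 (g z₀), y ∈ φ₀.target := φ₀.open_target.mem_nhds hmemt
    have h2 := hsymm.eventually_analyticAt
    have h3 : ∀ᶠ y in 𝓝 (g z₀), φ₀.symm y ∈ Z :=
      hsymm.continuousAt.eventually_mem (by rw [hsz]; exact hZ.mem_nhds hz₀)
    have h4 : ∀ᶠ y in 𝓝 (g z₀), y.1 ∈ X :=
      continuous_fst.continuousAt.eventually_mem (hX.mem_nhds (hmaps hz₀))
    filter_upwards [h1, h2, h3, h4] with y a1 a2 a3 a4 using ⟨a1, a2, a3, a4⟩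
  obtain ⟨U₁, hU₁, V₁, hV₁, hsub⟩ := mem_nhds_prod_iff.1 hN
  obtain ⟨U, hUU, hUo, hUm⟩ := mem_nhds_iff.1 hU₁
  obtain ⟨V, hVV, hVo, hVm⟩ := mem_nhds_iff.1 hV₁
  have hbox : U ×ˢ V ⊆
      {y | y ∈ φ₀.target ∧ AnalyticAt ℂ φ₀.symm y ∧ φ₀.symm y ∈ Z ∧ y.1 ∈ X} :=
    (Set.prod_mono hUU hVV).trans hsub
  let φ := (φ₀.symm.restrOpen (U ×ˢ V) (hUo.prod hVo)).symm
  have hφt : φ.target = U ×ˢ V := by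
    change φ₀.symm.source ∩ U ×ˢ V = U ×ˢ V
    exact Set.inter_eq_right.2 fun y hy => (hbox hy).1
  have hφc : ∀ z, φ z = g z := fun z => rfl
  have hφs : ∀ y, φ.symm y = φ₀.symm y := fun y => rfl
  have hsrcZ : φ.source ⊆ Z := by
    intro z hz
    have h1 : φ z ∈ U ×ˢ V := hφt ▸ φ.map_source hz
    have h2 := (hbox h1).2.2.1
    rwa [← hφs, φ.left_inv hz] at h2
  refine ⟨d, φ, U, V, ?_, hsrcZ, hUo, fun u hu => (hbox (show (u, (g z₀).2) ∈ U ×ˢ V from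
    ⟨hu, hVm⟩)).2.2.2, hVo, hφt, fun z hz => hgan z (hsrcZ hz), ?_, fun z _ => rfl⟩
  · have h1 : g z₀ ∈ φ.target := hφt ▸ ⟨hUm, hVm⟩
    have h2 := φ.map_target h1
    rwa [hφs, hsz] at h2
  · intro y hy
    exact (hbox (hφt ▸ hy)).2.1

/-- The vertical tangent vectors of a submersion are the velocities of curves in the fibre. -/
theorem IsHolomorphicSubmersion.exists_curve {h : E → F} {Z : Set E} {X : Set F}
    (hh : IsHolomorphicSubmersion h Z X) {z : E} (hz : z ∈ Z) {δ : E}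
    (hδ : fderiv ℂ h z δ = 0) :
    ∃ γ : ℂ → E, γ 0 = z ∧ HasDerivAt γ δ 0 ∧ ∀ᶠ t in 𝓝 0, γ t ∈ Z ∧ h (γ t) = h z := by
  obtain ⟨d, φ, U, V, hzs, hsZ, hU, hUX, hV, hφt, hφa, hφsa, hφh⟩ := hh.locally_projection z hz
  have hD : HasFDerivAt φ (fderiv ℂ φ z) z := (hφa z hzs).differentiableAt.hasFDerivAt
  have hzt : φ z ∈ φ.target := φ.map_source hzs
  have hDs : HasFDerivAt φ.symm (fderiv ℂ φ.symm (φ z)) (φ z) :=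
    (hφsa _ hzt).differentiableAt.hasFDerivAt
  have hfst : (fderiv ℂ φ z δ).1 = 0 := by
    have h1 : HasFDerivAt (fun x => (φ x).1)
        ((ContinuousLinearMap.fst ℂ F (Fin d → ℂ)).comp (fderiv ℂ φ z)) z :=
      hasFDerivAt_fst.comp z hD
    have h2 : (fun x => (φ x).1) =ᶠ[𝓝 z] h := by
      filter_upwards [φ.open_source.mem_nhds hzs] with x hx using hφh x hx
    have h3 := (h1.congr_of_eventuallyEq h2.symm).fderiv
    rw [h3] at hδ
    exact hδ
  have hcomp : fderiv ℂ φ.symm (φ z) (fderiv ℂ φ z δ) = δ := by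
    have h1 : HasFDerivAt (φ.symm ∘ φ) ((fderiv ℂ φ.symm (φ z)).comp (fderiv ℂ φ z)) z :=
      hDs.comp z hD
    have h2 : (φ.symm ∘ φ) =ᶠ[𝓝 z] id := by
      filter_upwards [φ.open_source.mem_nhds hzs] with x hx using φ.left_inv hx
    have h3 := (h1.congr_of_eventuallyEq h2.symm).unique (hasFDerivAt_id z)
    exact DFunLike.congr_fun h3 δ
  -- In the chart δ has no component along the base, so a straight line stays in the fibre.
  let ℓ : ℂ → F × (Fin d → ℂ) := fun t => φ z + t • fderiv ℂ φ z δ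
  have hℓ : HasDerivAt ℓ (fderiv ℂ φ z δ) 0 := by
    have := ((hasDerivAt_id (0 : ℂ)).smul_const (fderiv ℂ φ z δ)).const_add (φ z)
    rw [one_smul] at this
    exact this
  have hℓ0 : ℓ 0 = φ z := by simp [ℓ]
  refine ⟨fun t => φ.symm (ℓ t), by simp [hℓ0, φ.left_inv hzs], ?_, ?_⟩
  · have := HasFDerivAt.comp_hasDerivAt (0 : ℂ) (hℓ0 ▸ hDs : HasFDerivAt φ.symm _ (ℓ 0)) hℓ
    rw [hℓ0, hcomp] at this
    exact this
  · have h1 : ∀ᶠ t in 𝓝 (0 : ℂ), ℓ t ∈ φ.target :=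
      hℓ.continuousAt.eventually_mem (by rw [hℓ0]; exact φ.open_target.mem_nhds hzt)
    filter_upwards [h1] with t ht
    have h2 := φ.map_target ht
    refine ⟨hsZ h2, ?_⟩
    rw [← hφh _ h2, φ.right_inv ht, ← hφh _ hzs]
    simp [ℓ, hfst]

end Submersion

/-! ### Sprays -/

section Spray

variable {E F : Type*} [NormedAddCommGroup E] [NormedSpace ℂ E]
  [NormedAddCommGroup F] [NormedSpace ℂ F]

/-- The trivial holomorphic vector bundle of rank `r`. -/
noncomputable def trivialHolomorphicBundle (W : Set E) (r : ℕ) :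
    HolomorphicVectorBundle W r Unit where
  toVectorBundleCore :=
    { baseSet := fun _ => Set.univ
      isOpen_baseSet := fun _ => isOpen_univ
      indexAt := fun _ => ()
      mem_baseSet_at := fun _ => Set.mem_univ _
      coordChange := fun _ _ _ => ContinuousLinearMap.id ℂ _
      coordChange_self := fun _ _ _ _ => rfl
      continuousOn_coordChange := fun _ _ => continuousOn_const
      coordChange_comp := fun _ _ _ _ _ _ => rfl }
  holomorphic_coordChange := fun _ _ _ _ =>
    ⟨fun _ => ContinuousLinearMap.id ℂ _, analyticAt_const, Filter.Eventually.of_forall fun _ => rfl⟩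

/-- A holomorphic family of maps of the ambient space that preserves the fibres of `h`, starts at
the identity and moves every point in all vertical directions defines a dominating spray. -/
theorem exists_isDominatingFiberSpray {h : E → F} {Z W : Set E} {r : ℕ}
    (σ : E → (Fin r → ℂ) → E)
    (hσ : ∀ z ∈ W, ∀ t, AnalyticAt ℂ (fun p : E × (Fin r → ℂ) => σ p.1 p.2) (z, t))
    (hh : ∀ z ∈ W, DifferentiableAt ℂ h z)
    (hfib : ∀ z ∈ W, ∀ t, σ z t ∈ Z ∧ h (σ z t) = h z)
    (hzero : ∀ z ∈ W, σ z 0 = z)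
    (hdom : ∀ z ∈ W, ∀ δ, fderiv ℂ h z δ = 0 → ∃ τ, fderiv ℂ (σ z) 0 τ = δ) :
    ∃ (r : ℕ) (ι : Type) (B : HolomorphicVectorBundle W r ι) (s : B.TotalSpace → E),
      IsDominatingFiberSpray h Z W B s := by
  refine ⟨r, Unit, trivialHolomorphicBundle W r, fun p => σ (p.1 : E) p.2, ?_, ?_, ?_, ?_⟩
  · intro i z hz v
    exact ⟨fun p => σ p.1 p.2, hσ z z.2 v, Filter.Eventually.of_forall fun y => rfl⟩
  · intro z v
    exact hfib z z.2 v
  · intro z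
    exact hzero z z.2
  · intro z
    have hd : DifferentiableAt ℂ (σ z) 0 := by
      have h1 : DifferentiableAt ℂ (fun p : E × (Fin r → ℂ) => σ p.1 p.2) ((z : E), 0) :=
        (hσ z z.2 0).differentiableAt
      exact h1.comp (0 : Fin r → ℂ)
        ((differentiableAt_const (z : E)).prodMk differentiableAt_id)
    apply le_antisymm
    · rintro _ ⟨τ, rfl⟩
      have h1 : HasFDerivAt (fun t => h (σ z t)) ((fderiv ℂ h z).comp (fderiv ℂ (σ z) 0)) 0 := by
        have h2 : HasFDerivAt h (fderiv ℂ h z) (σ z 0) := by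
          rw [hzero z z.2]; exact (hh z z.2).hasFDerivAt
        exact h2.comp (0 : Fin r → ℂ) hd.hasFDerivAt
      have h3 : (fun t => h (σ z t)) = fun _ => h z := funext fun t => (hfib z z.2 t).2
      rw [h3] at h1
      exact DFunLike.congr_fun (h1.unique (hasFDerivAt_const _ _)) τ
    · intro δ hδ
      obtain ⟨τ, hτ⟩ := hdom z z.2 δ hδ
      exact ⟨τ, hτ⟩

end Spray

/-! ### Flows preserving a multi-affine function -/

section Koszul

/-- The entire function `(exp u - 1) / u`. -/
noncomputable def expSlope (u : ℂ) : ℂ := dslope Complex.exp 0 u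

theorem mul_expSlope (u : ℂ) : u * expSlope u = Complex.exp u - 1 := by
  have h := sub_smul_dslope Complex.exp 0 u
  rw [sub_zero, Complex.exp_zero, smul_eq_mul] at h
  exact h

theorem expSlope_zero : expSlope 0 = 1 := by
  simp [expSlope, dslope_same]

theorem analyticAt_expSlope (u : ℂ) : AnalyticAt ℂ expSlope u := by
  have h : DifferentiableOn ℂ expSlope Set.univ :=
    (Complex.differentiableOn_dslope Filter.univ_mem).2 Complex.differentiable_exp.differentiableOn
  exact h.analyticAt Filter.univ_mem

/-- `(exp (t b) - 1) / b`, extended by `t` to `b = 0`. -/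
noncomputable def expInt (t b : ℂ) : ℂ := t * expSlope (t * b)

theorem mul_expInt (t b : ℂ) : b * expInt t b = Complex.exp (t * b) - 1 := by
  rw [← mul_expSlope, expInt]; ring

/-- This is the cancellation that makes the flow below preserve f and have the time-reversed flow as
its inverse. -/
theorem exp_mul_expInt_neg (t b : ℂ) : Complex.exp (t * b) * expInt (-t) b = -expInt t b := by
  by_cases hb : b = 0
  · simp [hb, expInt, expSlope_zero]
  · apply mul_left_cancel₀ hb
    rw [mul_left_comm, mul_expInt, mul_neg, mul_expInt, mul_sub, ← Complex.exp_add]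
    simp

theorem expInt_zero_left (b : ℂ) : expInt 0 b = 0 := by simp [expInt]

variable {E : Type*} [NormedAddCommGroup E] [NormedSpace ℂ E]

/-- `f` is affine on all lines of direction `d`. -/
def AffineAlong (f : E → ℂ) (d : E) : Prop :=
  ∀ (x : E) (t : ℂ), f (x + t • d) = f x + t * (f (x + d) - f x)

/-- The difference of `f` in direction `d`. -/
def diffAlong {E : Type*} [AddCommGroup E] (f : E → ℂ) (d x : E) : ℂ := f (x + d) - f x

theorem AffineAlong.add_smul {f : E → ℂ} {d : E} (hf : AffineAlong f d) (x : E) (t : ℂ) :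
    f (x + t • d) = f x + t * diffAlong f d x := hf x t

theorem AffineAlong.diffAlong_right {f : E → ℂ} {d : E} (hf : AffineAlong f d) (d' : E) :
    AffineAlong (diffAlong f d') d := by
  intro x t
  simp only [diffAlong]
  rw [add_right_comm x (t • d) d', hf.add_smul, hf.add_smul, diffAlong, diffAlong,
    add_right_comm x d d']
  ring

theorem AffineAlong.diffAlong_add_smul {f : E → ℂ} {d : E} (hf : AffineAlong f d) (x : E) (t : ℂ) :
    diffAlong f d (x + t • d) = diffAlong f d x := by
  have h : x + t • d + d = x + (t + 1) • d := by rw [_root_.add_smul, one_smul, add_assoc]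
  rw [diffAlong, h, hf.add_smul x (t + 1), hf.add_smul x t]
  ring

theorem diffAlong_comm {E : Type*} [AddCommGroup E] (f : E → ℂ) (d d' x : E) :
    diffAlong (diffAlong f d) d' x = diffAlong (diffAlong f d') d x := by
  simp only [diffAlong]
  rw [add_right_comm x d d']
  ring

/-- For a function affine along d the difference is the derivative, so the flows can be handled
purely algebraically. -/
theorem AffineAlong.fderiv_apply {f : E → ℂ} {d : E} (hf : AffineAlong f d) {x : E}
    (hd : DifferentiableAt ℂ f x) : fderiv ℂ f x d = diffAlong f d x := by
  have h1 : HasDerivAt (fun t : ℂ => x + t • d) d 0 := by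
    have := ((hasDerivAt_id (0 : ℂ)).smul_const d).const_add x
    rw [one_smul] at this
    exact this
  have h2 : HasDerivAt (fun t : ℂ => f (x + t • d)) (fderiv ℂ f x d) 0 :=
    HasFDerivAt.comp_hasDerivAt (0 : ℂ)
      (by simpa using hd.hasFDerivAt : HasFDerivAt f (fderiv ℂ f x) (x + (0 : ℂ) • d)) h1
  have h3 : HasDerivAt (fun t : ℂ => f (x + t • d)) (diffAlong f d x) 0 := by
    simp only [hf.add_smul]
    simpa using ((hasDerivAt_id (0 : ℂ)).mul_const (diffAlong f d x)).const_add (f x)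
  exact h2.unique h3

/-- The flow of the Koszul vector field of `f` in the plane spanned by two directions. -/
noncomputable def koszulFlow (f : E → ℂ) (d d' : E) (t : ℂ) (x : E) : E :=
  x + (diffAlong f d' x * expInt t (diffAlong (diffAlong f d') d x)) • d +
    (diffAlong f d x * expInt (-t) (diffAlong (diffAlong f d') d x)) • d'

theorem koszulFlow_zero (f : E → ℂ) (d d' x : E) : koszulFlow f d d' 0 x = x := by
  simp [koszulFlow, expInt_zero_left]

section

variable {f : E → ℂ} {d d' : E}

/-- Along the Koszul field the mixed difference b is constant, and the two partial differences
satisfy linear equations with rates b and -b. They are therefore exponentials, and `expInt` is their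
time integral. -/
theorem diffAlong_koszulFlow_right (hd : AffineAlong f d) (hd' : AffineAlong f d')
    (t : ℂ) (x : E) : diffAlong f d' (koszulFlow f d d' t x) =
      diffAlong f d' x * Complex.exp (t * diffAlong (diffAlong f d') d x) := by
  rw [koszulFlow, hd'.diffAlong_add_smul, (hd.diffAlong_right d').add_smul]
  linear_combination diffAlong f d' x * mul_expInt t (diffAlong (diffAlong f d') d x)

theorem diffAlong_koszulFlow_left (hd : AffineAlong f d) (hd' : AffineAlong f d')
    (t : ℂ) (x : E) : diffAlong f d (koszulFlow f d d' t x) =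
      diffAlong f d x * Complex.exp (-t * diffAlong (diffAlong f d') d x) := by
  rw [koszulFlow, add_right_comm, hd.diffAlong_add_smul, (hd'.diffAlong_right d).add_smul,
    diffAlong_comm f d d']
  linear_combination diffAlong f d x * mul_expInt (-t) (diffAlong (diffAlong f d') d x)

theorem diffAlong_diffAlong_koszulFlow (hd : AffineAlong f d) (hd' : AffineAlong f d')
    (t : ℂ) (x : E) : diffAlong (diffAlong f d') d (koszulFlow f d d' t x) =
      diffAlong (diffAlong f d') d x := by
  rw [koszulFlow, ← diffAlong_comm, (hd'.diffAlong_right d).diffAlong_add_smul, diffAlong_comm,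
    (hd.diffAlong_right d').diffAlong_add_smul]

/-- With p = `expInt t b` and q = `expInt (-t) b`, the increment of f is αβ(p + q + bpq) = αβ(p +
exp(tb) q) = 0. -/
theorem apply_koszulFlow (hd : AffineAlong f d) (hd' : AffineAlong f d') (t : ℂ) (x : E) :
    f (koszulFlow f d d' t x) = f x := by
  rw [koszulFlow, hd'.add_smul, hd.add_smul, (hd.diffAlong_right d').add_smul]
  set b := diffAlong (diffAlong f d') d x
  set α := diffAlong f d x
  set β := diffAlong f d' x
  linear_combination α * β * expInt (-t) b * mul_expInt t b + α * β * exp_mul_expInt_neg t b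

theorem koszulFlow_neg_koszulFlow (hd : AffineAlong f d) (hd' : AffineAlong f d') (t : ℂ) (x : E) :
    koszulFlow f d d' (-t) (koszulFlow f d d' t x) = x := by
  conv_lhs => rw [koszulFlow]
  rw [diffAlong_koszulFlow_right hd hd', diffAlong_koszulFlow_left hd hd',
    diffAlong_diffAlong_koszulFlow hd hd', koszulFlow]
  set b := diffAlong (diffAlong f d') d x
  set α := diffAlong f d x
  set β := diffAlong f d' x
  have h1 : β * Complex.exp (t * b) * expInt (-t) b = -(β * expInt t b) := by
    linear_combination β * exp_mul_expInt_neg t b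
  have h2 : α * Complex.exp (-t * b) * expInt (- -t) b = -(α * expInt (-t) b) := by
    linear_combination α * exp_mul_expInt_neg (-t) b
  rw [h1, h2, neg_smul, neg_smul]
  abel

/-- A flow along two of the directions fixes the points where all differences vanish. -/
theorem exists_diffAlong_koszulFlow_ne {ι : Type*} {D : ι → E} (hD : ∀ i, AffineAlong f (D i))
    (i j : ι) (t : ℂ) {x : E} (hx : ∃ k, diffAlong f (D k) x ≠ 0) :
    ∃ k, diffAlong f (D k) (koszulFlow f (D i) (D j) t x) ≠ 0 := by
  -- At an image point where all differences vanish the inverse flow is stationary, so x would be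
  -- that same point.
  by_contra! hcon
  have h1 := koszulFlow_neg_koszulFlow (hD i) (hD j) t x
  conv_lhs at h1 => rw [koszulFlow]
  rw [hcon i, hcon j, zero_mul, zero_mul, zero_smul, zero_smul, add_zero, add_zero] at h1
  obtain ⟨k, hk⟩ := hx
  exact hk (h1 ▸ hcon k)

theorem analyticAt_diffAlong (hf : ∀ x, AnalyticAt ℂ f x) (d x : E) :
    AnalyticAt ℂ (diffAlong f d) x := by
  have h1 : AnalyticAt ℂ (fun y => y + d) x := analyticAt_id.add analyticAt_const
  exact (AnalyticAt.fun_comp (f := fun y => y + d) (hf (x + d)) h1).sub (hf x)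

theorem analyticAt_koszulFlow (hf : ∀ x, AnalyticAt ℂ f x) (d d' : E) (p : E × ℂ) :
    AnalyticAt ℂ (fun p : E × ℂ => koszulFlow f d d' p.2 p.1) p := by
  have hdiff : ∀ g : E → ℂ, (∀ x, AnalyticAt ℂ g x) → AnalyticAt ℂ (fun p : E × ℂ => g p.1) p :=
    fun g hg => (hg p.1).fun_comp analyticAt_fst
  have hb := hdiff _ (analyticAt_diffAlong (analyticAt_diffAlong hf d') d)
  have hexp : ∀ τ : E × ℂ → ℂ, AnalyticAt ℂ τ p → AnalyticAt ℂ
      (fun p : E × ℂ => expInt (τ p) (diffAlong (diffAlong f d') d p.1)) p := fun τ hτ =>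
    hτ.mul ((analyticAt_expSlope _).fun_comp (hτ.mul hb))
  exact (analyticAt_fst.add (((hdiff _ (analyticAt_diffAlong hf d')).mul
    (hexp _ analyticAt_snd)).smul analyticAt_const)).add (((hdiff _ (analyticAt_diffAlong hf d)).mul
    (hexp _ analyticAt_snd.neg)).smul analyticAt_const)

theorem hasDerivAt_koszulFlow (f : E → ℂ) (d d' x : E) :
    HasDerivAt (fun t => koszulFlow f d d' t x)
      (diffAlong f d' x • d - diffAlong f d x • d') 0 := by
  have hexp : ∀ b : ℂ, HasDerivAt (fun t => expInt t b) 1 0 := by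
    intro b
    have h1 : HasDerivAt (fun t : ℂ => expSlope (t * b))
        (deriv (fun t : ℂ => expSlope (t * b)) 0) 0 := by
      have : AnalyticAt ℂ (fun t : ℂ => expSlope (t * b)) 0 :=
        (analyticAt_expSlope _).fun_comp (analyticAt_id.mul analyticAt_const)
      exact this.differentiableAt.hasDerivAt
    have h2 := (hasDerivAt_id (0 : ℂ)).mul h1
    simp only [id, zero_mul, expSlope_zero, mul_one, add_zero] at h2
    exact h2
  have hneg : ∀ b : ℂ, HasDerivAt (fun t => expInt (-t) b) (-1) 0 := by
    intro b
    have h1 : HasDerivAt (fun t => expInt t b) 1 (-(0 : ℂ)) := by simpa using hexp b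
    have h2 := h1.comp (0 : ℂ) (hasDerivAt_neg (0 : ℂ))
    rw [one_mul] at h2
    exact h2
  have h := ((((hexp (diffAlong (diffAlong f d') d x)).const_mul
    (diffAlong f d' x)).smul_const d).const_add x).add
    (((hneg (diffAlong (diffAlong f d') d x)).const_mul (diffAlong f d x)).smul_const d')
  rw [mul_one, mul_neg_one, neg_smul, ← sub_eq_add_neg] at h
  exact h

end

/-- The composition of the flows for a list of pairs of directions. -/
noncomputable def koszulComp {ι : Type*} (f : E → ℂ) (D : ι → E) :
    List (ι × ι) → E → (ι × ι → ℂ) → E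
  | [], x, _ => x
  | p :: l, x, t => koszulFlow f (D p.1) (D p.2) (t p) (koszulComp f D l x t)

section

variable {ι : Type*} {f : E → ℂ} {D : ι → E}

theorem koszulComp_zero (l : List (ι × ι)) (x : E) : koszulComp f D l x 0 = x := by
  induction l with
  | nil => rfl
  | cons p l ih => rw [koszulComp, ih, Pi.zero_apply, koszulFlow_zero]

theorem apply_koszulComp (hD : ∀ i, AffineAlong f (D i)) (l : List (ι × ι)) (x : E)
    (t : ι × ι → ℂ) : f (koszulComp f D l x t) = f x := by
  induction l with
  | nil => rfl
  | cons p l ih => rw [koszulComp, apply_koszulFlow (hD _) (hD _), ih]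

theorem exists_diffAlong_koszulComp_ne (hD : ∀ i, AffineAlong f (D i)) (l : List (ι × ι)) {x : E}
    (t : ι × ι → ℂ) (hx : ∃ k, diffAlong f (D k) x ≠ 0) :
    ∃ k, diffAlong f (D k) (koszulComp f D l x t) ≠ 0 := by
  induction l with
  | nil => exact hx
  | cons p l ih => exact exists_diffAlong_koszulFlow_ne hD _ _ _ ih

variable [Fintype ι]

theorem analyticAt_koszulComp (hf : ∀ x, AnalyticAt ℂ f x) (l : List (ι × ι))
    (q : E × (ι × ι → ℂ)) :
    AnalyticAt ℂ (fun q : E × (ι × ι → ℂ) => koszulComp f D l q.1 q.2) q := by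
  induction l with
  | nil => exact analyticAt_fst
  | cons p l ih =>
    have h1 : AnalyticAt ℂ (fun q : E × (ι × ι → ℂ) => q.2 p) q :=
      ((ContinuousLinearMap.proj p : (ι × ι → ℂ) →L[ℂ] ℂ).analyticAt _).fun_comp analyticAt_snd
    exact (analyticAt_koszulFlow hf (D p.1) (D p.2) _).fun_comp (AnalyticAt.prod ih h1)

/-- Each flow is the identity at time 0, so to first order the composition adds up the Koszul
vectors at x. -/
theorem hasFDerivAt_koszulComp (hf : ∀ x, AnalyticAt ℂ f x) (l : List (ι × ι)) (x : E) :
    HasFDerivAt (fun t => koszulComp f D l x t)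
      ((l.map fun p => (ContinuousLinearMap.proj p : (ι × ι → ℂ) →L[ℂ] ℂ).smulRight
        (diffAlong f (D p.2) x • D p.1 - diffAlong f (D p.1) x • D p.2)).sum) 0 := by
  induction l with
  | nil => exact hasFDerivAt_const x 0
  | cons p l ih =>
    set G : E × ℂ → E := fun q => koszulFlow f (D p.1) (D p.2) q.2 q.1
    have hG : HasFDerivAt G (fderiv ℂ G (x, 0)) (x, 0) :=
      (analyticAt_koszulFlow hf (D p.1) (D p.2) (x, 0)).differentiableAt.hasFDerivAt
    have hG1 : ∀ δ, fderiv ℂ G (x, 0) (δ, 0) = δ := by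
      have h1 : HasFDerivAt (fun y : E => G (y, 0))
          ((fderiv ℂ G (x, 0)).comp (ContinuousLinearMap.inl ℂ E ℂ)) x :=
        HasFDerivAt.comp x (f := fun y : E => (y, (0 : ℂ))) hG (hasFDerivAt_prodMk_left x (0 : ℂ))
      have h2 : (fun y : E => G (y, 0)) = id := funext fun y => koszulFlow_zero _ _ _ _
      rw [h2] at h1
      intro δ
      exact DFunLike.congr_fun (h1.unique (hasFDerivAt_id x)) δ
    have hG2 : ∀ s : ℂ, fderiv ℂ G (x, 0) (0, s) =
        s • (diffAlong f (D p.2) x • D p.1 - diffAlong f (D p.1) x • D p.2) := by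
      have h1 : HasFDerivAt (fun s : ℂ => G (x, s))
          ((fderiv ℂ G (x, 0)).comp (ContinuousLinearMap.inr ℂ E ℂ)) 0 :=
        HasFDerivAt.comp (0 : ℂ) (f := fun s : ℂ => (x, s)) hG (hasFDerivAt_prodMk_right x 0)
      have h2 := h1.unique (hasDerivAt_koszulFlow f (D p.1) (D p.2) x).hasFDerivAt
      intro s
      simpa using DFunLike.congr_fun h2 s
    have hp : HasFDerivAt (fun t : ι × ι → ℂ => t p)
        (ContinuousLinearMap.proj p : (ι × ι → ℂ) →L[ℂ] ℂ) 0 :=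
      (ContinuousLinearMap.proj p : (ι × ι → ℂ) →L[ℂ] ℂ).hasFDerivAt
    have h0 : (koszulComp f D l x (0 : ι × ι → ℂ), (0 : ι × ι → ℂ) p) = (x, (0 : ℂ)) := by
      rw [koszulComp_zero]; rfl
    have h3 := HasFDerivAt.comp (0 : ι × ι → ℂ) (by rw [h0]; exact hG) (ih.prodMk hp)
    refine h3.congr_fderiv (ContinuousLinearMap.ext fun t => Eq.symm ?_)
    rw [List.map_cons, List.sum_cons, ContinuousLinearMap.comp_apply,
      ContinuousLinearMap.prod_apply]
    set u := ((l.map fun p => (ContinuousLinearMap.proj p : (ι × ι → ℂ) →L[ℂ] ℂ).smulRight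
        (diffAlong f (D p.2) x • D p.1 - diffAlong f (D p.1) x • D p.2)).sum) t with hu
    have h4 : ((u, t p) : E × ℂ) = (u, 0) + (0, t p) := by simp
    rw [add_apply, ← hu, ContinuousLinearMap.proj_apply, h4, map_add, hG1, hG2,
      add_comm]
    simp

end

end Koszul

/-! ### Sprays on fibres that are retracts of level sets -/

section FiberSpray

variable {E F : Type*} [NormedAddCommGroup E] [NormedSpace ℂ E]
  [NormedAddCommGroup F] [NormedSpace ℂ F]

/-- If the fibres of `h` over a set are holomorphic retracts, by `R`, of level sets of a
multi-affine function `Q`, the flows preserving `Q` give a dominating fibre spray. -/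
theorem exists_spray_of_retraction {ι : Type*} [Fintype ι] {h : E → F} {Z : Set E} {X : Set F}
    (hh : IsHolomorphicSubmersion h Z X) {W : Set E} (hWZ : W ⊆ Z) {Q : E → ℂ} {D : ι → E}
    (hspan : Submodule.span ℂ (Set.range D) = ⊤)
    (hQ : ∀ x, AnalyticAt ℂ Q x) (hD : ∀ i, AffineAlong Q (D i)) {R : F → E → E}
    (hR : ∀ z ∈ W, ∀ x, AnalyticAt ℂ (fun p : F × E => R p.1 p.2) (h z, x))
    (hne : ∀ z ∈ W, ∃ i, diffAlong Q (D i) z ≠ 0)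
    (hfib : ∀ z ∈ W, ∀ x, Q x = Q z → (∃ i, diffAlong Q (D i) x ≠ 0) →
      R (h z) x ∈ Z ∧ h (R (h z) x) = h z)
    (hid : ∀ z ∈ W, ∀ x ∈ Z, h x = h z → Q x = Q z ∧ R (h z) x = x) :
    ∃ (r : ℕ) (ι : Type) (B : HolomorphicVectorBundle W r ι) (s : B.TotalSpace → E),
      IsDominatingFiberSpray h Z W B s := by
  classical
  let e := Fintype.equivFin (ι × ι)
  let l : List (ι × ι) := Finset.univ.toList
  let C : (Fin (Fintype.card (ι × ι)) → ℂ) →L[ℂ] (ι × ι → ℂ) :=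
    ContinuousLinearMap.pi fun p => ContinuousLinearMap.proj (e p)
  have hana : ∀ z ∈ W, AnalyticAt ℂ h z := fun z hz => hh.holomorphic z (hWZ hz)
  refine exists_isDominatingFiberSpray (fun z t => R (h z) (koszulComp Q D l z (C t)))
    ?_ (fun z hz => (hana z hz).differentiableAt) ?_ ?_ ?_
  · intro z hz t
    have h1 : AnalyticAt ℂ (fun p : E × (Fin (Fintype.card (ι × ι)) → ℂ) => h p.1) (z, t) :=
      (hana z hz).fun_comp analyticAt_fst
    have h2 : AnalyticAt ℂ (fun p : E × (Fin (Fintype.card (ι × ι)) → ℂ) =>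
        koszulComp Q D l p.1 (C p.2)) (z, t) :=
      AnalyticAt.fun_comp (g := fun q : E × (ι × ι → ℂ) => koszulComp Q D l q.1 q.2)
        (f := fun p : E × (Fin (Fintype.card (ι × ι)) → ℂ) => (p.1, C p.2))
        (analyticAt_koszulComp (D := D) hQ l (z, C t)) (AnalyticAt.prod analyticAt_fst
        (AnalyticAt.fun_comp (f := fun p : E × (Fin (Fintype.card (ι × ι)) → ℂ) => p.2)
          (C.analyticAt t) analyticAt_snd))
    exact AnalyticAt.fun_comp (g := fun q : F × E => R q.1 q.2)
      (f := fun p : E × (Fin (Fintype.card (ι × ι)) → ℂ) => (h p.1, koszulComp Q D l p.1 (C p.2)))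
      (hR z hz _) (AnalyticAt.prod h1 h2)
  · intro z hz t
    exact hfib z hz _ (apply_koszulComp hD l z _) (exists_diffAlong_koszulComp_ne hD l _ (hne z hz))
  · intro z hz
    simp only [map_zero, koszulComp_zero]
    exact (hid z hz z (hWZ hz) rfl).2
  · intro z hz δ hδ
    -- A vertical vector is the velocity of a curve in the fibre. There Q is constant and the
    -- retraction is the identity, so dQ kills δ and the differential of the retraction fixes it.
    obtain ⟨γ, hγ0, hγ, hγZ⟩ := hh.exists_curve (hWZ hz) hδ
    have hQδ : fderiv ℂ Q z δ = 0 := by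
      have h1 : HasDerivAt (fun t => Q (γ t)) (fderiv ℂ Q z δ) 0 :=
        HasFDerivAt.comp_hasDerivAt (0 : ℂ)
          (by rw [hγ0]; exact (hQ z).differentiableAt.hasFDerivAt) hγ
      have h2 : (fun t => Q (γ t)) =ᶠ[𝓝 0] fun _ => Q z := by
        filter_upwards [hγZ] with t ht using (hid z hz _ ht.1 ht.2).1
      exact (h1.congr_of_eventuallyEq h2.symm).unique (hasDerivAt_const _ _)
    have hRd : HasFDerivAt (R (h z)) (fderiv ℂ (R (h z)) z) z := by
      have h1 : AnalyticAt ℂ (fun x => R (h z) x) z :=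
        (hR z hz z).fun_comp (AnalyticAt.prod analyticAt_const analyticAt_id)
      exact h1.differentiableAt.hasFDerivAt
    have hRδ : fderiv ℂ (R (h z)) z δ = δ := by
      have h1 : HasDerivAt (fun t => R (h z) (γ t)) (fderiv ℂ (R (h z)) z δ) 0 :=
        HasFDerivAt.comp_hasDerivAt (0 : ℂ) (by rw [hγ0]; exact hRd) hγ
      have h2 : (fun t => R (h z) (γ t)) =ᶠ[𝓝 0] γ := by
        filter_upwards [hγZ] with t ht using (hid z hz _ ht.1 ht.2).2
      exact (h1.congr_of_eventuallyEq h2.symm).unique hγ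
    obtain ⟨i₀, hi₀⟩ := hne z hz
    have hδs : δ ∈ Submodule.span ℂ (Set.range D) := hspan ▸ Submodule.mem_top
    obtain ⟨a, rfl⟩ := (Submodule.mem_span_range_iff_exists_fun ℂ).1 hδs
    have hsum : ∑ i, a i * diffAlong Q (D i) z = 0 := by
      rw [← hQδ, map_sum]
      refine Finset.sum_congr rfl fun i _ => ?_
      rw [map_smul, (hD i).fderiv_apply (hQ z).differentiableAt, smul_eq_mul]
    -- Only the pairs (i, i₀) are used. Their Koszul vectors, scaled by these times, add up to δ
    -- minus a multiple of D i₀ whose coefficient is proportional to dQ(δ) = 0.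
    let T : ι × ι → ℂ := fun p => if p.2 = i₀ then a p.1 / diffAlong Q (D i₀) z else 0
    have hCT : C (fun k => T (e.symm k)) = T := by
      ext p; simp [C]
    refine ⟨fun k => T (e.symm k), ?_⟩
    have hK : HasFDerivAt (fun t => R (h z) (koszulComp Q D l z (C t))) _ 0 :=
      HasFDerivAt.comp (0 : Fin (Fintype.card (ι × ι)) → ℂ)
        (g := R (h z)) (f := fun t => koszulComp Q D l z (C t))
        (by rw [map_zero, koszulComp_zero]; exact hRd)
        (HasFDerivAt.comp (0 : Fin (Fintype.card (ι × ι)) → ℂ) (g := koszulComp Q D l z) (f := C)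
          (by rw [map_zero]; exact hasFDerivAt_koszulComp hQ l z) C.hasFDerivAt)
    rw [hK.fderiv, ContinuousLinearMap.comp_apply, ContinuousLinearMap.comp_apply, hCT]
    have hval : ((l.map fun p => (ContinuousLinearMap.proj p : (ι × ι → ℂ) →L[ℂ] ℂ).smulRight
        (diffAlong Q (D p.2) z • D p.1 - diffAlong Q (D p.1) z • D p.2)).sum) T =
        ∑ i, a i • D i := by
      rw [Finset.sum_map_toList, sum_apply, Fintype.sum_prod_type]
      have h1 : ∀ i, (∑ j, ((ContinuousLinearMap.proj (i, j) : (ι × ι → ℂ) →L[ℂ] ℂ).smulRight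
          (diffAlong Q (D j) z • D i - diffAlong Q (D i) z • D j)) T) =
          a i • D i - ((a i * diffAlong Q (D i) z) / diffAlong Q (D i₀) z) • D i₀ := by
        intro i
        rw [Finset.sum_eq_single i₀]
        · simp only [ContinuousLinearMap.smulRight_apply, ContinuousLinearMap.proj_apply, T, if_true]
          rw [smul_sub, smul_smul, smul_smul, div_mul_cancel₀ _ hi₀]
          congr 2
          ring
        · intro j _ hj
          simp [T, hj]
        · simp
      simp only [h1]
      rw [Finset.sum_sub_distrib, ← Finset.sum_smul, ← Finset.sum_div, hsum]
      simp
    rw [hval, hRδ]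

end FiberSpray

/-! ### Unitriangular matrices and coordinates -/

section Coordinates

variable {n : ℕ}

/-- Upper unitriangular matrices. -/
def IsUnitri (A : Matrix (Fin n) (Fin n) ℂ) : Prop :=
  (∀ i j, j < i → A i j = 0) ∧ ∀ i, A i i = 1

theorem IsUnitri.det_eq_one {A : Matrix (Fin n) (Fin n) ℂ} (hA : IsUnitri A) : A.det = 1 := by
  rw [Matrix.det_of_isUpperTriangular (fun i j h => hA.1 i j h)]
  simp [hA.2]

theorem IsUnitri.isUnit_det {A : Matrix (Fin n) (Fin n) ℂ} (hA : IsUnitri A) : IsUnit A.det := by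
  rw [hA.det_eq_one]; exact isUnit_one

theorem isUnitri_one : IsUnitri (1 : Matrix (Fin n) (Fin n) ℂ) :=
  ⟨fun _ _ h => Matrix.one_apply_ne h.ne', fun _ => Matrix.one_apply_eq _⟩

theorem IsUnitri.mul_apply_self {A B : Matrix (Fin n) (Fin n) ℂ}
    (hA : ∀ i j, j < i → A i j = 0) (hB : ∀ i j, j < i → B i j = 0) (i : Fin n) :
    (A * B) i i = A i i * B i i := by
  rw [Matrix.mul_apply, Finset.sum_eq_single i]
  · intro j _ hj
    rcases lt_or_gt_of_ne hj with h | h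
    · rw [hA i j h, zero_mul]
    · rw [hB j i h, mul_zero]
  · simp

theorem IsUnitri.mul {A B : Matrix (Fin n) (Fin n) ℂ} (hA : IsUnitri A) (hB : IsUnitri B) :
    IsUnitri (A * B) := by
  refine ⟨fun i j h => ?_, fun i => ?_⟩
  · rw [Matrix.mul_apply]
    refine Finset.sum_eq_zero fun k _ => ?_
    rcases lt_or_ge k i with h' | h'
    · rw [hA.1 i k h', zero_mul]
    · rw [hB.1 k j (h.trans_le h'), mul_zero]
  · rw [IsUnitri.mul_apply_self hA.1 hB.1, hA.2, hB.2, one_mul]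

theorem IsUnitri.inv {A : Matrix (Fin n) (Fin n) ℂ} (hA : IsUnitri A) : IsUnitri A⁻¹ := by
  have : Invertible A := A.invertibleOfIsUnitDet hA.isUnit_det
  have h1 : ∀ i j, j < i → A⁻¹ i j = 0 := fun i j h =>
    Matrix.blockTriangular_inv_of_blockTriangular (b := id) (fun i j h => hA.1 i j h) h
  refine ⟨h1, fun i => ?_⟩
  have h2 := IsUnitri.mul_apply_self hA.1 h1 i
  rw [Matrix.mul_nonsing_inv _ hA.isUnit_det, Matrix.one_apply_eq, hA.2, one_mul] at h2
  exact h2.symm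

/-- The entries above the diagonal. -/
def triCoord (A : Matrix (Fin n) (Fin n) ℂ) : UnitriCoord n := fun p => A p.1.1 p.1.2

/-- The coordinates of the symmetric part of a matrix. -/
noncomputable def symCoord (B : Matrix (Fin n) (Fin n) ℂ) : SymCoord n :=
  Sym2.lift ⟨fun i j => (B i j + B j i) / 2, fun i j => congrArg (· / 2) (add_comm (B i j) (B j i))⟩

theorem isUnitri_unitriMatrix (a : UnitriCoord n) : IsUnitri (unitriMatrix a) := by
  refine ⟨fun i j h => ?_, fun i => ?_⟩
  · simp [unitriMatrix, h.not_gt, h.ne']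
  · simp [unitriMatrix]

theorem unitriMatrix_triCoord {A : Matrix (Fin n) (Fin n) ℂ} (hA : IsUnitri A) :
    unitriMatrix (triCoord A) = A := by
  ext i j
  rcases lt_trichotomy i j with h | h | h
  · simp [unitriMatrix, triCoord, h]
  · subst h; simp [unitriMatrix, hA.2]
  · simp [unitriMatrix, h.not_gt, h.ne', hA.1 i j h]

theorem triCoord_unitriMatrix (a : UnitriCoord n) : triCoord (unitriMatrix a) = a := by
  ext ⟨⟨i, j⟩, h⟩
  have h' : i < j := h
  simp [triCoord, unitriMatrix, h']

theorem symMatrix_transpose (z : SymCoord n) : (symMatrix z)ᵀ = symMatrix z := by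
  ext i j
  simp [symMatrix, Sym2.eq_swap]

theorem symMatrix_symCoord {B : Matrix (Fin n) (Fin n) ℂ} (hB : Bᵀ = B) :
    symMatrix (symCoord B) = B := by
  ext i j
  have h : B j i = B i j := congrFun (congrFun hB i) j
  simp [symMatrix, symCoord, h]

theorem symCoord_symMatrix (z : SymCoord n) : symCoord (symMatrix z) = z := by
  ext w
  induction w with
  | _ i j =>
    have h : z s(j, i) = z s(i, j) := by rw [Sym2.eq_swap]
    simp [symMatrix, symCoord, h]

theorem elemMinus_eq (A Z : Matrix (Fin n) (Fin n) ℂ) :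
    elemMinus A Z = Matrix.fromBlocks (A⁻¹)ᵀ 0 (Z * (A⁻¹)ᵀ) A := by
  simp [elemMinus, Matrix.fromBlocks_multiply]

theorem elemPlus_eq (A Z : Matrix (Fin n) (Fin n) ℂ) :
    elemPlus A Z = Matrix.fromBlocks A⁻¹ (Z * Aᵀ) 0 Aᵀ := by
  simp [elemPlus, Matrix.fromBlocks_multiply]

/-- All arguments for the sign + reduce to the sign - by exchanging the halves, at the price of
inverting A. -/
theorem elemPlus_eq_submatrix {A : Matrix (Fin n) (Fin n) ℂ} (hA : IsUnitri A)
    (Z : Matrix (Fin n) (Fin n) ℂ) :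
    elemPlus A Z = (elemMinus A⁻¹ Z).submatrix Sum.swap Sum.swap := by
  rw [elemPlus_eq, elemMinus_eq, Matrix.nonsing_inv_nonsing_inv _ hA.isUnit_det]
  ext (i | i) (j | j) <;> rfl

/-- For symmetric Z and W this is the law of a semidirect product, with A acting on symmetric
matrices by W ↦ A W Aᵀ. Multiplying a factor by a group element thus amounts to a change of its
parameters. -/
theorem elemMinus_mul {A C : Matrix (Fin n) (Fin n) ℂ} (hA : IsUnitri A)
    (Z W : Matrix (Fin n) (Fin n) ℂ) :
    elemMinus A Z * elemMinus C W = elemMinus (A * C) (Z + A * W * Aᵀ) := by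
  have h : Aᵀ * (A⁻¹)ᵀ = 1 := by
    rw [← Matrix.transpose_mul, Matrix.nonsing_inv_mul _ hA.isUnit_det, Matrix.transpose_one]
  rw [elemMinus_eq, elemMinus_eq, elemMinus_eq, Matrix.fromBlocks_multiply, Matrix.mul_inv_rev,
    Matrix.transpose_mul]
  congr 1
  · simp
  · simp
  · rw [add_mul, Matrix.mul_assoc Z, Matrix.mul_assoc (A * W), ← Matrix.mul_assoc Aᵀ, h,
      Matrix.one_mul, Matrix.mul_assoc A W]
  · simp

theorem elemMinus_one_zero : elemMinus (1 : Matrix (Fin n) (Fin n) ℂ) 0 = 1 := by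
  simp [elemMinus_eq]

end Coordinates

/-! ### Holomorphic matrix functions -/

section EntryAnalytic

variable {G : Type*} [NormedAddCommGroup G] [NormedSpace ℂ G] {l m k : Type*}

/-- All entries of the matrix function `f` are holomorphic at `x`. -/
def EntryAnalytic (f : G → Matrix l m ℂ) (x : G) : Prop :=
  ∀ i j, AnalyticAt ℂ (fun g => f g i j) x

theorem EntryAnalytic.const (A : Matrix l m ℂ) (x : G) : EntryAnalytic (fun _ => A) x :=
  fun _ _ => analyticAt_const

theorem EntryAnalytic.add {f g : G → Matrix l m ℂ} {x : G} (hf : EntryAnalytic f x)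
    (hg : EntryAnalytic g x) : EntryAnalytic (fun y => f y + g y) x :=
  fun i j => (hf i j).add (hg i j)

theorem EntryAnalytic.sub {f g : G → Matrix l m ℂ} {x : G} (hf : EntryAnalytic f x)
    (hg : EntryAnalytic g x) : EntryAnalytic (fun y => f y - g y) x :=
  fun i j => (hf i j).sub (hg i j)

theorem EntryAnalytic.smul {f : G → Matrix l m ℂ} {c : G → ℂ} {x : G} (hc : AnalyticAt ℂ c x)
    (hf : EntryAnalytic f x) : EntryAnalytic (fun y => c y • f y) x :=
  fun i j => hc.mul (hf i j)

theorem EntryAnalytic.transpose {f : G → Matrix l m ℂ} {x : G} (hf : EntryAnalytic f x) :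
    EntryAnalytic (fun y => (f y)ᵀ) x :=
  fun i j => hf j i

theorem EntryAnalytic.mul [Fintype m] {f : G → Matrix l m ℂ} {g : G → Matrix m k ℂ} {x : G}
    (hf : EntryAnalytic f x) (hg : EntryAnalytic g x) : EntryAnalytic (fun y => f y * g y) x :=
  fun i j => Finset.analyticAt_fun_sum _ fun a _ => (hf i a).mul (hg a j)

theorem EntryAnalytic.vecMul [Fintype m] {u : G → m → ℂ} {g : G → Matrix m k ℂ} {x : G}
    (hu : ∀ i, AnalyticAt ℂ (fun y => u y i) x) (hg : EntryAnalytic g x) (j : k) :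
    AnalyticAt ℂ (fun y => (u y ᵥ* g y) j) x :=
  Finset.analyticAt_fun_sum _ fun a _ => (hu a).mul (hg a j)

theorem EntryAnalytic.det [Fintype m] [DecidableEq m] {f : G → Matrix m m ℂ} {x : G}
    (hf : EntryAnalytic f x) : AnalyticAt ℂ (fun y => (f y).det) x := by
  simp only [Matrix.det_apply']
  exact Finset.analyticAt_fun_sum _ fun σ _ =>
    analyticAt_const.mul (Finset.analyticAt_fun_prod _ fun a _ => hf _ _)

/-- By Cramer's rule the entries are quotients of determinants, so it is enough that the determinant
is nonzero at x itself. -/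
theorem EntryAnalytic.inv [Fintype m] [DecidableEq m] {f : G → Matrix m m ℂ} {x : G}
    (hf : EntryAnalytic f x) (hx : (f x).det ≠ 0) : EntryAnalytic (fun y => (f y)⁻¹) x := by
  intro i j
  simp only [Matrix.inv_def, Ring.inverse_eq_inv', Matrix.smul_apply, smul_eq_mul,
    Matrix.adjugate_apply]
  refine (hf.det.inv hx).mul (EntryAnalytic.det fun a b => ?_)
  by_cases h : a = j
  · subst h; simp only [Matrix.updateRow_self]; exact analyticAt_const
  · simp only [Matrix.updateRow_ne h]; exact hf a b

theorem EntryAnalytic.fromBlocks {l' m' : Type*} {a : G → Matrix l m ℂ} {b : G → Matrix l m' ℂ}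
    {c : G → Matrix l' m ℂ} {d : G → Matrix l' m' ℂ} {x : G} (ha : EntryAnalytic a x)
    (hb : EntryAnalytic b x) (hc : EntryAnalytic c x) (hd : EntryAnalytic d x) :
    EntryAnalytic (fun y => Matrix.fromBlocks (a y) (b y) (c y) (d y)) x := by
  rintro (i | i) (j | j)
  · exact ha i j
  · exact hb i j
  · exact hc i j
  · exact hd i j

theorem EntryAnalytic.unitriMatrix {n : ℕ} {a : G → UnitriCoord n} {x : G}
    (ha : AnalyticAt ℂ a x) : EntryAnalytic (fun y => unitriMatrix (a y)) x := by
  intro i j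
  by_cases h : i < j
  · simp only [_root_.unitriMatrix, Matrix.of_apply, h, dite_true]
    exact analyticAt_pi_iff.1 ha _
  · simp only [_root_.unitriMatrix, Matrix.of_apply, h, dite_false]
    exact analyticAt_const

theorem EntryAnalytic.symMatrix {n : ℕ} {z : G → SymCoord n} {x : G}
    (hz : AnalyticAt ℂ z x) : EntryAnalytic (fun y => symMatrix (z y)) x :=
  fun _ _ => analyticAt_pi_iff.1 hz _

theorem EntryAnalytic.triCoord {n : ℕ} {f : G → Matrix (Fin n) (Fin n) ℂ} {x : G}
    (hf : EntryAnalytic f x) : AnalyticAt ℂ (fun y => triCoord (f y)) x :=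
  analyticAt_pi_iff.2 fun _ => hf _ _

theorem EntryAnalytic.symCoord {n : ℕ} {f : G → Matrix (Fin n) (Fin n) ℂ} {x : G}
    (hf : EntryAnalytic f x) : AnalyticAt ℂ (fun y => symCoord (f y)) x := by
  refine analyticAt_pi_iff.2 fun w => ?_
  induction w with
  | _ i j => exact ((hf i j).add (hf j i)).mul analyticAt_const

end EntryAnalytic

/-! ### Pivots -/

section Pivot

variable {n : ℕ}

/-- The rank of a coordinate in the order `q₁, …, qₙ, pₙ, …, p₁` of the coordinates of
`(p, q) ∈ ℂⁿ × ℂⁿ`. -/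
def pivRank : Fin n ⊕ Fin n → ℕ
  | Sum.inr i => i
  | Sum.inl j => 2 * n - 1 - j

theorem pivRank_injective : Function.Injective (pivRank : Fin n ⊕ Fin n → ℕ) := by
  rintro (i | i) (j | j) h <;> simp only [pivRank] at h
  · congr 1; ext; omega
  · omega
  · omega
  · congr 1; ext; omega

/-- Exchanging the halves reverses the order. Consecutive factors, having opposite signs, are
therefore unitriangular for opposite orders. -/
theorem pivRank_swap (l : Fin n ⊕ Fin n) : pivRank l.swap = 2 * n - 1 - pivRank l := by
  rcases l with i | i <;> simp only [pivRank, Sum.swap_inl, Sum.swap_inr]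
  omega

theorem pivRank_lt (l : Fin n ⊕ Fin n) : pivRank l < 2 * n := by
  rcases l with i | i <;> simp only [pivRank] <;> omega

/-- `M` is unitriangular for the order of the indices given by `pivRank`. -/
def IsPivTri (M : Matrix (Fin n ⊕ Fin n) (Fin n ⊕ Fin n) ℂ) : Prop :=
  (∀ k l, pivRank l < pivRank k → M k l = 0) ∧ ∀ k, M k k = 1

/-- A row (p, q) goes to (p A⁻ᵀ + q Z A⁻ᵀ, q A). The part q is transformed in increasing order of
its indices, p in decreasing order, and q enters p but not conversely. -/
theorem isPivTri_elemMinus {A : Matrix (Fin n) (Fin n) ℂ} (hA : IsUnitri A)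
    (Z : Matrix (Fin n) (Fin n) ℂ) : IsPivTri (elemMinus A Z) := by
  rw [elemMinus_eq]
  refine ⟨?_, ?_⟩
  · rintro (i | i) (j | j) h <;> simp only [pivRank] at h
    · exact hA.inv.1 j i (by omega)
    · rfl
    · omega
    · exact hA.1 i j (by omega)
  · rintro (i | i)
    · exact hA.inv.2 i
    · exact hA.2 i

theorem IsPivTri.vecMul_apply_eq_zero {M : Matrix (Fin n ⊕ Fin n) (Fin n ⊕ Fin n) ℂ}
    (hM : IsPivTri M) {u : Fin n ⊕ Fin n → ℂ} {d : Fin n ⊕ Fin n}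
    (hu : ∀ l, pivRank l < pivRank d → u l = 0) {l : Fin n ⊕ Fin n}
    (hl : pivRank l < pivRank d) : (u ᵥ* M) l = 0 := by
  rw [Matrix.vecMul, dotProduct]
  refine Finset.sum_eq_zero fun k _ => ?_
  rcases lt_or_ge (pivRank k) (pivRank d) with h | h
  · rw [hu k h, zero_mul]
  · rw [hM.1 k l (hl.trans_le h), mul_zero]

theorem IsPivTri.vecMul_apply_pivot {M : Matrix (Fin n ⊕ Fin n) (Fin n ⊕ Fin n) ℂ}
    (hM : IsPivTri M) {u : Fin n ⊕ Fin n → ℂ} {d : Fin n ⊕ Fin n}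
    (hu : ∀ l, pivRank l < pivRank d → u l = 0) : (u ᵥ* M) d = u d := by
  rw [Matrix.vecMul, dotProduct, Finset.sum_eq_single d, hM.2, mul_one]
  · intro k _ hk
    rcases lt_or_gt_of_ne (pivRank_injective.ne hk) with h | h
    · rw [hu k h, zero_mul]
    · rw [hM.1 k d h, mul_zero]
  · simp

/-- The unitriangular part of the group element that moves the coordinates of `u` behind the pivot
`d`, where `u d = c`, to those of `v`. -/
noncomputable def pivC (d : Fin n ⊕ Fin n) (c : ℂ) (u v : Fin n ⊕ Fin n → ℂ) :
    Matrix (Fin n) (Fin n) ℂ :=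
  match d with
  | Sum.inr i => 1 + Matrix.vecMulVec (Pi.single i 1)
      (fun j => if i < j then (v (Sum.inr j) - u (Sum.inr j)) * c⁻¹ else 0)
  | Sum.inl j => 1 - Matrix.vecMulVec
      (fun k => if k < j then (v (Sum.inl k) - u (Sum.inl k)) * c⁻¹ else 0) (Pi.single j 1)

/-- The right-hand side of the equation for the symmetric part. -/
noncomputable def pivB (i : Fin n) (c : ℂ) (u v : Fin n ⊕ Fin n → ℂ) : Fin n → ℂ :=
  (fun k => v (Sum.inl k)) ᵥ* (pivC (Sum.inr i) c u v)ᵀ - fun k => u (Sum.inl k)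

/-- The symmetric part of the group element that moves the coordinates of `u` behind the pivot
`d`, where `u d = c`, to those of `v`. -/
noncomputable def pivW (d : Fin n ⊕ Fin n) (c : ℂ) (u v : Fin n ⊕ Fin n → ℂ) :
    Matrix (Fin n) (Fin n) ℂ :=
  match d with
  | Sum.inr i =>
      c⁻¹ • (Matrix.vecMulVec (pivB i c u v) (Pi.single i 1) +
        Matrix.vecMulVec (Pi.single i 1) (pivB i c u v)) -
      (c⁻¹ * c⁻¹ * ((fun k => u (Sum.inr k)) ⬝ᵥ pivB i c u v)) •
        Matrix.vecMulVec (Pi.single i 1) (Pi.single i 1)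
  | Sum.inl _ => 0

theorem isUnitri_pivC (d : Fin n ⊕ Fin n) (c : ℂ) (u v : Fin n ⊕ Fin n → ℂ) :
    IsUnitri (pivC d c u v) := by
  rcases d with j | i
  · refine ⟨fun a b h => ?_, fun a => ?_⟩
    · by_cases hb : b = j
      · subst hb; simp [pivC, Matrix.vecMulVec_apply, Matrix.one_apply_ne h.ne', h.not_gt]
      · simp [pivC, Matrix.vecMulVec_apply, Matrix.one_apply_ne h.ne', hb]
    · by_cases hb : a = j
      · subst hb; simp [pivC, Matrix.vecMulVec_apply]
      · simp [pivC, Matrix.vecMulVec_apply, hb]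
  · refine ⟨fun a b h => ?_, fun a => ?_⟩
    · by_cases hb : a = i
      · subst hb; simp [pivC, Matrix.vecMulVec_apply, Matrix.one_apply_ne h.ne', h.not_gt]
      · simp [pivC, Matrix.vecMulVec_apply, Matrix.one_apply_ne h.ne', hb]
    · by_cases hb : a = i
      · subst hb; simp [pivC, Matrix.vecMulVec_apply]
      · simp [pivC, Matrix.vecMulVec_apply, hb]

theorem pivW_transpose (d : Fin n ⊕ Fin n) (c : ℂ) (u v : Fin n ⊕ Fin n → ℂ) :
    (pivW d c u v)ᵀ = pivW d c u v := by
  rcases d with j | i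
  · simp [pivW]
  · simp only [pivW, Matrix.transpose_sub, Matrix.transpose_smul, Matrix.transpose_add,
      Matrix.transpose_vecMulVec]
    rw [add_comm]

theorem pivC_inl_inv (j : Fin n) (c : ℂ) (u v : Fin n ⊕ Fin n → ℂ) :
    (pivC (Sum.inl j) c u v)⁻¹ = 1 + Matrix.vecMulVec
      (fun k => if k < j then (v (Sum.inl k) - u (Sum.inl k)) * c⁻¹ else 0) (Pi.single j 1) := by
  apply Matrix.inv_eq_right_inv
  have h : ∀ w : Fin n → ℂ, w j = 0 →
      Matrix.vecMulVec w (Pi.single j 1) * Matrix.vecMulVec w (Pi.single j 1) = 0 := by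
    intro w hw
    rw [Matrix.vecMulVec_mul_vecMulVec]
    simp [hw]
  simp only [pivC]
  rw [sub_mul, mul_add, mul_add, h _ (by simp)]
  simp

/-- For a pivot in the second half, `pivC` corrects the later entries of q, and it remains to solve
q W = b with W symmetric and q i = c. The solution used is c⁻¹(b eᵢᵀ + eᵢ bᵀ) - c⁻²(q·b) eᵢ eᵢᵀ. For
a pivot in the first half a unitriangular matrix suffices. The coordinates of u in front of the
pivot are arbitrary, which is essential for the last factor but one. -/
theorem pivot_vecMul_apply_of_gt {d : Fin n ⊕ Fin n} {c : ℂ} (hc : c ≠ 0)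
    {u : Fin n ⊕ Fin n → ℂ} (hu : u d = c) (v : Fin n ⊕ Fin n → ℂ) {l : Fin n ⊕ Fin n}
    (hl : pivRank d < pivRank l) :
    (u ᵥ* elemMinus (pivC d c u v) (pivW d c u v)) l = v l := by
  rcases d with j | i
  · rcases l with k | k
    · have hkj : k < j := by simp only [pivRank] at hl; omega
      rw [elemMinus_eq, pivC_inl_inv, Matrix.vecMul_fromBlocks]
      simp only [pivW, zero_mul, Matrix.vecMul_zero, add_zero, Sum.elim_inl, Function.comp_def,
        Matrix.transpose_add, Matrix.transpose_one, Matrix.transpose_vecMulVec, Matrix.vecMul_add,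
        Matrix.vecMul_one, Matrix.vecMul_vecMulVec, Pi.add_apply, Pi.smul_apply, hkj, if_true,
        dotProduct_single, mul_one, hu, smul_eq_mul]
      field_simp
      ring
    · simp only [pivRank] at hl; omega
  · rw [elemMinus_eq]
    rw [Matrix.vecMul_fromBlocks]
    have hCC : (pivC (Sum.inr i) c u v)ᵀ * ((pivC (Sum.inr i) c u v)⁻¹)ᵀ = 1 := by
      rw [← Matrix.transpose_mul, Matrix.nonsing_inv_mul _ (isUnitri_pivC _ _ _ _).isUnit_det,
        Matrix.transpose_one]
    rcases l with k | k
    · have hW : (fun k => u (Sum.inr k)) ᵥ* pivW (Sum.inr i) c u v = pivB i c u v := by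
        ext k
        simp only [pivW, Matrix.vecMul_sub, Matrix.vecMul_smul, Matrix.vecMul_add,
          Matrix.vecMul_vecMulVec, Pi.sub_apply, Pi.smul_apply, Pi.add_apply, dotProduct_single,
          mul_one, hu, smul_eq_mul]
        field_simp
        ring
      simp only [Sum.elim_inl, Function.comp_def]
      rw [← Matrix.vecMul_vecMul, hW, ← Matrix.add_vecMul, pivB, add_sub_cancel,
        Matrix.vecMul_vecMul, hCC, Matrix.vecMul_one]
    · have hik : i < k := by simp only [pivRank] at hl; exact hl
      simp only [Sum.elim_inr, Function.comp_def, Matrix.vecMul_zero, zero_add, pivC,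
        Matrix.vecMul_add, Matrix.vecMul_one, Matrix.vecMul_vecMulVec, Pi.add_apply, Pi.smul_apply,
        dotProduct_single, mul_one, hu, hik, if_true, smul_eq_mul]
      field_simp
      ring

/-- The correcting element fixes the pivot column, so it leaves the pivot coordinate of every row
unchanged, not just of the row it was built for. -/
theorem pivot_mulVec_single (d : Fin n ⊕ Fin n) (c : ℂ) (u v : Fin n ⊕ Fin n → ℂ) :
    elemMinus (pivC d c u v) (pivW d c u v) *ᵥ Pi.single d 1 = Pi.single d 1 := by
  rw [Matrix.mulVec_single_one, elemMinus_eq]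
  ext k
  rcases d with j | i
  · rw [pivC_inl_inv]
    rcases k with k | k
    · by_cases hk : k = j
      · subst hk; simp [Matrix.vecMulVec_apply]
      · simp [Matrix.vecMulVec_apply, hk]
    · simp [pivW]
  · rcases k with k | k
    · simp
    · by_cases hk : k = i
      · subst hk; simp [pivC, Matrix.vecMulVec_apply]
      · simp [pivC, Matrix.vecMulVec_apply, hk]

theorem pivC_eq_one {d : Fin n ⊕ Fin n} {c : ℂ} {u v : Fin n ⊕ Fin n → ℂ}
    (h : ∀ l, pivRank d < pivRank l → u l = v l) : pivC d c u v = 1 := by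
  rcases d with j | i
  · have hw : (fun k => if k < j then (v (Sum.inl k) - u (Sum.inl k)) * c⁻¹ else 0) = 0 := by
      ext k
      by_cases hk : k < j
      · simp [hk, h (Sum.inl k) (by simp only [pivRank]; omega)]
      · simp [hk]
    simp [pivC, hw]
  · have hw : (fun k => if i < k then (v (Sum.inr k) - u (Sum.inr k)) * c⁻¹ else 0) = 0 := by
      ext k
      by_cases hk : i < k
      · simp [hk, h (Sum.inr k) (by simp only [pivRank]; omega)]
      · simp [hk]
    simp [pivC, hw]

theorem pivW_eq_zero {d : Fin n ⊕ Fin n} {c : ℂ} {u v : Fin n ⊕ Fin n → ℂ}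
    (h : ∀ l, pivRank d < pivRank l → u l = v l) : pivW d c u v = 0 := by
  rcases d with j | i
  · rfl
  · have hb : pivB i c u v = 0 := by
      ext k
      simp [pivB, pivC_eq_one h, h (Sum.inl k) (by simp only [pivRank]; omega)]
    simp [pivW, hb]

section

variable {G : Type*} [NormedAddCommGroup G] [NormedSpace ℂ G] {c : G → ℂ}
  {u v : G → Fin n ⊕ Fin n → ℂ} {x : G}

theorem EntryAnalytic.pivC (d : Fin n ⊕ Fin n) (hc : AnalyticAt ℂ c x) (hcx : c x ≠ 0)
    (hu : ∀ l, AnalyticAt ℂ (fun y => u y l) x) (hv : ∀ l, AnalyticAt ℂ (fun y => v y l) x) :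
    EntryAnalytic (fun y => pivC d (c y) (u y) (v y)) x := by
  have hif : ∀ (p : Prop) [Decidable p] (l : Fin n ⊕ Fin n),
      AnalyticAt ℂ (fun y => if p then (v y l - u y l) * (c y)⁻¹ else 0) x := by
    intro p _ l
    by_cases hp : p
    · simp only [hp, if_true]; exact ((hv l).sub (hu l)).mul (hc.inv hcx)
    · simp only [hp, if_false]; exact analyticAt_const
  rcases d with j | i
  · exact (EntryAnalytic.const 1 x).sub fun a b => (hif _ _).mul analyticAt_const
  · exact (EntryAnalytic.const 1 x).add fun a b => analyticAt_const.mul (hif _ _)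

theorem analyticAt_pivB (i k : Fin n) (hc : AnalyticAt ℂ c x) (hcx : c x ≠ 0)
    (hu : ∀ l, AnalyticAt ℂ (fun y => u y l) x) (hv : ∀ l, AnalyticAt ℂ (fun y => v y l) x) :
    AnalyticAt ℂ (fun y => pivB i (c y) (u y) (v y) k) x :=
  (EntryAnalytic.vecMul (fun _ => hv _)
    (EntryAnalytic.pivC (Sum.inr i) hc hcx hu hv).transpose k).sub (hu _)

theorem EntryAnalytic.pivW (d : Fin n ⊕ Fin n) (hc : AnalyticAt ℂ c x) (hcx : c x ≠ 0)
    (hu : ∀ l, AnalyticAt ℂ (fun y => u y l) x) (hv : ∀ l, AnalyticAt ℂ (fun y => v y l) x) :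
    EntryAnalytic (fun y => pivW d (c y) (u y) (v y)) x := by
  rcases d with j | i
  · exact EntryAnalytic.const 0 x
  · have hb := fun k => analyticAt_pivB i k hc hcx hu hv
    have hi := hc.inv hcx
    refine EntryAnalytic.sub (EntryAnalytic.smul hi (EntryAnalytic.add
      (fun a b => (hb a).mul analyticAt_const) fun a b => analyticAt_const.mul (hb b)))
      (EntryAnalytic.smul ((hi.mul hi).mul ?_) (EntryAnalytic.const _ x))
    exact Finset.analyticAt_fun_sum _ fun k _ => (hu _).mul (hb k)

end

end Pivot

/-! ### The factors of both signs -/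

section Step

variable {n : ℕ}

/-- The identity for the sign `-` (`true`), the exchange of the two halves of the coordinates for
the sign `+` (`false`). -/
def signSwap : Bool → (Fin n ⊕ Fin n ≃ Fin n ⊕ Fin n)
  | true => Equiv.refl _
  | false => Equiv.sumComm _ _

theorem signSwap_signSwap (s : Bool) (l : Fin n ⊕ Fin n) : signSwap s (signSwap s l) = l := by
  cases s
  · exact Sum.swap_swap l
  · rfl

/-- Conjugation by the exchange of the two halves for the sign `+`. -/
def signConj (s : Bool) (M : Matrix (Fin n ⊕ Fin n) (Fin n ⊕ Fin n) ℂ) :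
    Matrix (Fin n ⊕ Fin n) (Fin n ⊕ Fin n) ℂ :=
  M.submatrix (signSwap s) (signSwap s)

/-- The factor `M⁻` (for `true`) or `M⁺` (for `false`). -/
noncomputable def stepMat (s : Bool) (y : UnitriCoord n × SymCoord n) :
    Matrix (Fin n ⊕ Fin n) (Fin n ⊕ Fin n) ℂ :=
  if s = true then elemMinus (unitriMatrix y.1) (symMatrix y.2)
  else elemPlus (unitriMatrix y.1) (symMatrix y.2)

/-- The unitriangular matrix of a factor, inverted for the sign `+`. -/
noncomputable def stepTri (s : Bool) (y : UnitriCoord n × SymCoord n) : Matrix (Fin n) (Fin n) ℂ :=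
  match s with
  | true => unitriMatrix y.1
  | false => (unitriMatrix y.1)⁻¹

/-- The coordinates of the factor of sign `s` with given `stepTri` and symmetric matrix. -/
noncomputable def stepCoord (s : Bool) (A Z : Matrix (Fin n) (Fin n) ℂ) :
    UnitriCoord n × SymCoord n :=
  match s with
  | true => (triCoord A, symCoord Z)
  | false => (triCoord A⁻¹, symCoord Z)

theorem isUnitri_stepTri (s : Bool) (y : UnitriCoord n × SymCoord n) : IsUnitri (stepTri s y) := by
  cases s
  · exact (isUnitri_unitriMatrix y.1).inv
  · exact isUnitri_unitriMatrix y.1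

theorem stepMat_eq (s : Bool) (y : UnitriCoord n × SymCoord n) :
    stepMat s y = signConj s (elemMinus (stepTri s y) (symMatrix y.2)) := by
  cases s
  · exact elemPlus_eq_submatrix (isUnitri_unitriMatrix y.1) _
  · rfl

theorem stepMat_stepCoord (s : Bool) {A Z : Matrix (Fin n) (Fin n) ℂ} (hA : IsUnitri A)
    (hZ : Zᵀ = Z) : stepMat s (stepCoord s A Z) = signConj s (elemMinus A Z) := by
  rw [stepMat_eq]
  cases s
  · simp only [stepCoord, stepTri, unitriMatrix_triCoord hA.inv, symMatrix_symCoord hZ,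
      Matrix.nonsing_inv_nonsing_inv _ hA.isUnit_det]
  · simp only [stepCoord, stepTri, unitriMatrix_triCoord hA, symMatrix_symCoord hZ]

theorem stepCoord_stepTri (s : Bool) (y : UnitriCoord n × SymCoord n) :
    stepCoord s (stepTri s y) (symMatrix y.2) = y := by
  cases s
  · simp only [stepCoord, stepTri, symCoord_symMatrix, triCoord_unitriMatrix,
      Matrix.nonsing_inv_nonsing_inv _ (isUnitri_unitriMatrix y.1).isUnit_det]
  · simp only [stepCoord, stepTri, symCoord_symMatrix, triCoord_unitriMatrix]

theorem signConj_mul (s : Bool) (M N : Matrix (Fin n ⊕ Fin n) (Fin n ⊕ Fin n) ℂ) :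
    signConj s (M * N) = signConj s M * signConj s N :=
  (Matrix.submatrix_mul_equiv M N _ _ _).symm

theorem signConj_one (s : Bool) :
    signConj s (1 : Matrix (Fin n ⊕ Fin n) (Fin n ⊕ Fin n) ℂ) = 1 :=
  Matrix.submatrix_one_equiv _

theorem vecMul_signConj (s : Bool) (u : Fin n ⊕ Fin n → ℂ)
    (M : Matrix (Fin n ⊕ Fin n) (Fin n ⊕ Fin n) ℂ) (l : Fin n ⊕ Fin n) :
    (u ᵥ* signConj s M) l = ((u ∘ signSwap s) ᵥ* M) (signSwap s l) := by
  rw [Matrix.vecMul, dotProduct, Matrix.vecMul, dotProduct]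
  refine Fintype.sum_equiv (signSwap s) _ _ fun k => ?_
  simp [signConj, signSwap_signSwap]

theorem signConj_mulVec (s : Bool) (c : Fin n ⊕ Fin n → ℂ)
    (M : Matrix (Fin n ⊕ Fin n) (Fin n ⊕ Fin n) ℂ) (l : Fin n ⊕ Fin n) :
    (signConj s M *ᵥ c) l = (M *ᵥ (c ∘ signSwap s)) (signSwap s l) := by
  rw [Matrix.mulVec, dotProduct, Matrix.mulVec, dotProduct]
  refine Fintype.sum_equiv (signSwap s) _ _ fun k => ?_
  simp [signConj, signSwap_signSwap]

theorem vecMul_signConj_dotProduct (s : Bool) (u c : Fin n ⊕ Fin n → ℂ)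
    (M : Matrix (Fin n ⊕ Fin n) (Fin n ⊕ Fin n) ℂ) :
    (u ᵥ* signConj s M) ⬝ᵥ c = ((u ∘ signSwap s) ᵥ* M) ⬝ᵥ (c ∘ signSwap s) := by
  refine Fintype.sum_equiv (signSwap s) _ _ fun k => ?_
  rw [vecMul_signConj, Function.comp_apply, signSwap_signSwap]

/-- The rank of a coordinate in the order for which the factors of sign `s` are triangular. -/
def signRank (s : Bool) (l : Fin n ⊕ Fin n) : ℕ := pivRank (signSwap s l)

theorem signRank_not (s : Bool) (l : Fin n ⊕ Fin n) :
    signRank (!s) l = 2 * n - 1 - signRank s l := by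
  cases s
  · have h := pivRank_swap l.swap
    rw [Sum.swap_swap] at h
    exact h
  · exact pivRank_swap l

theorem signRank_lt (s : Bool) (l : Fin n ⊕ Fin n) : signRank s l < 2 * n := pivRank_lt _

theorem signRank_not_lt_iff (s : Bool) {l k : Fin n ⊕ Fin n} :
    signRank (!s) l < signRank (!s) k ↔ signRank s k < signRank s l := by
  have h1 := signRank_lt s l
  have h2 := signRank_lt s k
  rw [signRank_not, signRank_not]
  omega

theorem signRank_injective (s : Bool) : Function.Injective (signRank s : Fin n ⊕ Fin n → ℕ) :=
  pivRank_injective.comp (signSwap s).injective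

/-- The inverse of a factor. -/
noncomputable def stepInv (s : Bool) (y : UnitriCoord n × SymCoord n) :
    Matrix (Fin n ⊕ Fin n) (Fin n ⊕ Fin n) ℂ :=
  signConj s (elemMinus (stepTri s y)⁻¹
    (-((stepTri s y)⁻¹ * symMatrix y.2 * ((stepTri s y)⁻¹)ᵀ)))

theorem stepInv_mul_stepMat (s : Bool) (y : UnitriCoord n × SymCoord n) :
    stepInv s y * stepMat s y = 1 := by
  have hA := isUnitri_stepTri s y
  rw [stepInv, stepMat_eq, ← signConj_mul, elemMinus_mul hA.inv, neg_add_cancel,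
    Matrix.nonsing_inv_mul _ hA.isUnit_det, elemMinus_one_zero, signConj_one]

theorem stepMat_mul_stepInv (s : Bool) (y : UnitriCoord n × SymCoord n) :
    stepMat s y * stepInv s y = 1 :=
  mul_eq_one_comm.1 (stepInv_mul_stepMat s y)

section Triangular

variable {s : Bool} {d : Fin n ⊕ Fin n} {u : Fin n ⊕ Fin n → ℂ}

theorem comp_signSwap_eq_zero (hu : ∀ l, signRank s l < signRank s d → u l = 0)
    {l : Fin n ⊕ Fin n} (hl : pivRank l < pivRank (signSwap s d)) : (u ∘ signSwap s) l = 0 :=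
  hu _ (by rwa [signRank, signRank, signSwap_signSwap])

theorem vecMul_signConj_eq_zero {M : Matrix (Fin n ⊕ Fin n) (Fin n ⊕ Fin n) ℂ} (hM : IsPivTri M)
    (hu : ∀ l, signRank s l < signRank s d → u l = 0) {l : Fin n ⊕ Fin n}
    (hl : signRank s l < signRank s d) : (u ᵥ* signConj s M) l = 0 := by
  rw [vecMul_signConj]
  exact hM.vecMul_apply_eq_zero (d := signSwap s d) (fun _ => comp_signSwap_eq_zero hu) hl

theorem vecMul_signConj_pivot {M : Matrix (Fin n ⊕ Fin n) (Fin n ⊕ Fin n) ℂ} (hM : IsPivTri M)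
    (hu : ∀ l, signRank s l < signRank s d → u l = 0) : (u ᵥ* signConj s M) d = u d := by
  rw [vecMul_signConj, hM.vecMul_apply_pivot fun _ => comp_signSwap_eq_zero hu,
    Function.comp_apply, signSwap_signSwap]

theorem vecMul_stepMat_eq_zero (y : UnitriCoord n × SymCoord n)
    (hu : ∀ l, signRank s l < signRank s d → u l = 0) {l : Fin n ⊕ Fin n}
    (hl : signRank s l < signRank s d) : (u ᵥ* stepMat s y) l = 0 := by
  rw [stepMat_eq]
  exact vecMul_signConj_eq_zero (isPivTri_elemMinus (isUnitri_stepTri s y) _) hu hl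

theorem vecMul_stepMat_pivot (y : UnitriCoord n × SymCoord n)
    (hu : ∀ l, signRank s l < signRank s d → u l = 0) : (u ᵥ* stepMat s y) d = u d := by
  rw [stepMat_eq]
  exact vecMul_signConj_pivot (isPivTri_elemMinus (isUnitri_stepTri s y) _) hu

theorem vecMul_stepInv_eq_zero (y : UnitriCoord n × SymCoord n)
    (hu : ∀ l, signRank s l < signRank s d → u l = 0) {l : Fin n ⊕ Fin n}
    (hl : signRank s l < signRank s d) : (u ᵥ* stepInv s y) l = 0 :=
  vecMul_signConj_eq_zero (isPivTri_elemMinus (isUnitri_stepTri s y).inv _) hu hl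

theorem vecMul_stepInv_pivot (y : UnitriCoord n × SymCoord n)
    (hu : ∀ l, signRank s l < signRank s d → u l = 0) : (u ᵥ* stepInv s y) d = u d :=
  vecMul_signConj_pivot (isPivTri_elemMinus (isUnitri_stepTri s y).inv _) hu

end Triangular

/-- Change the factor with coordinates `y` on the right so that a row `u` with `u d = c` is moved
to a row that agrees with `v` behind the pivot `d`. -/
noncomputable def stepAdjust (s : Bool) (d : Fin n ⊕ Fin n) (c : ℂ) (u v : Fin n ⊕ Fin n → ℂ)
    (y : UnitriCoord n × SymCoord n) : UnitriCoord n × SymCoord n :=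
  stepCoord s
    (stepTri s y * pivC (signSwap s d) c (u ∘ signSwap s) (v ∘ signSwap s))
    (symMatrix y.2 + stepTri s y * pivW (signSwap s d) c (u ∘ signSwap s) (v ∘ signSwap s) *
      (stepTri s y)ᵀ)

theorem stepMat_stepAdjust (s : Bool) (d : Fin n ⊕ Fin n) (c : ℂ) (u v : Fin n ⊕ Fin n → ℂ)
    (y : UnitriCoord n × SymCoord n) :
    stepMat s (stepAdjust s d c u v y) = stepMat s y *
      signConj s (elemMinus (pivC (signSwap s d) c (u ∘ signSwap s) (v ∘ signSwap s))
        (pivW (signSwap s d) c (u ∘ signSwap s) (v ∘ signSwap s))) := by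
  have hA := isUnitri_stepTri s y
  rw [stepAdjust, stepMat_stepCoord s (hA.mul (isUnitri_pivC _ _ _ _)), stepMat_eq, ← signConj_mul,
    elemMinus_mul hA]
  rw [Matrix.transpose_add, symMatrix_transpose, Matrix.transpose_mul, Matrix.transpose_mul,
    pivW_transpose, Matrix.transpose_transpose, Matrix.mul_assoc]

theorem stepMat_stepAdjust_mulVec_single (s : Bool) (d : Fin n ⊕ Fin n) (c : ℂ)
    (u v : Fin n ⊕ Fin n → ℂ) (y : UnitriCoord n × SymCoord n) :
    stepMat s (stepAdjust s d c u v y) *ᵥ Pi.single d 1 = stepMat s y *ᵥ Pi.single d 1 := by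
  rw [stepMat_stepAdjust, ← Matrix.mulVec_mulVec]
  congr 1
  ext l
  have h : (Pi.single d 1 : Fin n ⊕ Fin n → ℂ) ∘ signSwap s = Pi.single (signSwap s d) 1 := by
    ext k
    by_cases hk : k = signSwap s d
    · subst hk; simp [signSwap_signSwap]
    · have hk' : signSwap s k ≠ d := fun e => hk (by rw [← e, signSwap_signSwap])
      simp [hk, hk']
  rw [signConj_mulVec, h, pivot_mulVec_single, ← h, Function.comp_apply, signSwap_signSwap]

theorem vecMul_stepAdjust_pivot (s : Bool) (d : Fin n ⊕ Fin n) (c : ℂ)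
    (r u v : Fin n ⊕ Fin n → ℂ) (y : UnitriCoord n × SymCoord n) :
    (r ᵥ* stepMat s (stepAdjust s d c u v y)) d = (r ᵥ* stepMat s y) d := by
  have h := congrArg (r ⬝ᵥ ·) (stepMat_stepAdjust_mulVec_single s d c u v y)
  simpa only [Matrix.dotProduct_mulVec, dotProduct_single, mul_one] using h

theorem vecMul_stepAdjust_of_gt {s : Bool} {d : Fin n ⊕ Fin n} {c : ℂ} (hc : c ≠ 0)
    {r u : Fin n ⊕ Fin n → ℂ} (v : Fin n ⊕ Fin n → ℂ) {y : UnitriCoord n × SymCoord n}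
    (hu : r ᵥ* stepMat s y = u) (hd : u d = c) {l : Fin n ⊕ Fin n}
    (hl : signRank s d < signRank s l) : (r ᵥ* stepMat s (stepAdjust s d c u v y)) l = v l := by
  rw [stepMat_stepAdjust, ← Matrix.vecMul_vecMul, hu, vecMul_signConj, pivot_vecMul_apply_of_gt hc
    (by rw [Function.comp_apply, signSwap_signSwap, hd]) _ hl, Function.comp_apply,
    signSwap_signSwap]

theorem stepAdjust_self {s : Bool} {d : Fin n ⊕ Fin n} {c : ℂ} {u v : Fin n ⊕ Fin n → ℂ}
    (y : UnitriCoord n × SymCoord n) (h : ∀ l, signRank s d < signRank s l → u l = v l) :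
    stepAdjust s d c u v y = y := by
  have h' : ∀ l, pivRank (signSwap s d) < pivRank l →
      (u ∘ signSwap s) l = (v ∘ signSwap s) l := fun l hl =>
    h _ (by rwa [signRank, signRank, signSwap_signSwap])
  rw [stepAdjust, pivC_eq_one h', pivW_eq_zero h', mul_one, mul_zero, zero_mul, add_zero,
    stepCoord_stepTri]

/-! ### Holomorphic dependence of the factors and their corrections -/

section Analytic

variable {G : Type*} [NormedAddCommGroup G] [NormedSpace ℂ G] {x : G}

theorem EntryAnalytic.stepTri (s : Bool) {y : G → UnitriCoord n × SymCoord n}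
    (hy : AnalyticAt ℂ y x) : EntryAnalytic (fun g => stepTri s (y g)) x := by
  have h1 : AnalyticAt ℂ (fun g => (y g).1) x := analyticAt_fst.fun_comp hy
  cases s
  · exact (EntryAnalytic.unitriMatrix h1).inv
      (by rw [(isUnitri_unitriMatrix _).det_eq_one]; exact one_ne_zero)
  · exact EntryAnalytic.unitriMatrix h1

theorem EntryAnalytic.elemMinus {A Z : G → Matrix (Fin n) (Fin n) ℂ} (hA : EntryAnalytic A x)
    (hA1 : IsUnitri (A x)) (hZ : EntryAnalytic Z x) :
    EntryAnalytic (fun g => elemMinus (A g) (Z g)) x := by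
  simp only [elemMinus_eq]
  have hi : EntryAnalytic (fun g => ((A g)⁻¹)ᵀ) x :=
    (hA.inv (by rw [hA1.det_eq_one]; exact one_ne_zero)).transpose
  exact EntryAnalytic.fromBlocks hi (EntryAnalytic.const 0 x) (hZ.mul hi) hA

theorem EntryAnalytic.symMatrix_snd {y : G → UnitriCoord n × SymCoord n}
    (hy : AnalyticAt ℂ y x) : EntryAnalytic (fun g => _root_.symMatrix (y g).2) x :=
  EntryAnalytic.symMatrix (analyticAt_snd.fun_comp hy)

theorem EntryAnalytic.stepMat (s : Bool) {y : G → UnitriCoord n × SymCoord n}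
    (hy : AnalyticAt ℂ y x) : EntryAnalytic (fun g => stepMat s (y g)) x := by
  simp only [stepMat_eq]
  intro i j
  exact EntryAnalytic.elemMinus (EntryAnalytic.stepTri s hy) (isUnitri_stepTri s _)
    (EntryAnalytic.symMatrix_snd hy) _ _

theorem EntryAnalytic.stepInv (s : Bool) {y : G → UnitriCoord n × SymCoord n}
    (hy : AnalyticAt ℂ y x) : EntryAnalytic (fun g => stepInv s (y g)) x := by
  intro i j
  have hA := (EntryAnalytic.stepTri s hy).inv
    (by rw [(isUnitri_stepTri s _).det_eq_one]; exact one_ne_zero)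
  refine EntryAnalytic.elemMinus hA (isUnitri_stepTri s _).inv (fun a b => ?_) _ _
  exact (((hA.mul (EntryAnalytic.symMatrix_snd hy)).mul hA.transpose) a b).neg

theorem EntryAnalytic.stepCoord (s : Bool) {A Z : G → Matrix (Fin n) (Fin n) ℂ}
    (hA : EntryAnalytic A x) (hA1 : IsUnitri (A x)) (hZ : EntryAnalytic Z x) :
    AnalyticAt ℂ (fun g => stepCoord s (A g) (Z g)) x := by
  cases s
  · exact AnalyticAt.prod
      (hA.inv (by rw [hA1.det_eq_one]; exact one_ne_zero)).triCoord hZ.symCoord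
  · exact AnalyticAt.prod hA.triCoord hZ.symCoord

theorem analyticAt_stepAdjust (s : Bool) (d : Fin n ⊕ Fin n) {c : G → ℂ}
    {u v : G → Fin n ⊕ Fin n → ℂ} {y : G → UnitriCoord n × SymCoord n}
    (hc : AnalyticAt ℂ c x) (hcx : c x ≠ 0) (hu : ∀ l, AnalyticAt ℂ (fun g => u g l) x)
    (hv : ∀ l, AnalyticAt ℂ (fun g => v g l) x) (hy : AnalyticAt ℂ y x) :
    AnalyticAt ℂ (fun g => stepAdjust s d (c g) (u g) (v g) (y g)) x := by
  have hA := EntryAnalytic.stepTri s hy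
  refine EntryAnalytic.stepCoord s (hA.mul (EntryAnalytic.pivC _ hc hcx (fun _ => hu _)
    fun _ => hv _)) ((isUnitri_stepTri s _).mul (isUnitri_pivC _ _ _ _)) ?_
  exact (EntryAnalytic.symMatrix_snd hy).add ((hA.mul (EntryAnalytic.pivW _ hc hcx (fun _ => hu _)
    fun _ => hv _)).mul hA.transpose)

end Analytic

end Step

/-! ### Coordinate directions -/

section Directions

variable {n : ℕ}

/-- The coordinate vectors of the parameter space of one factor. -/
def blockDir : ({p : Fin n × Fin n // p.1 < p.2} ⊕ Sym2 (Fin n)) → UnitriCoord n × SymCoord n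
  | Sum.inl p => (Pi.single p 1, 0)
  | Sum.inr w => (0, Pi.single w 1)

theorem unitriMatrix_add_smul_single (a : UnitriCoord n) (p : {p : Fin n × Fin n // p.1 < p.2})
    (t : ℂ) : unitriMatrix (a + t • Pi.single p 1) =
      unitriMatrix a + t • Matrix.single p.1.1 p.1.2 1 := by
  ext i j
  by_cases h : i < j
  · by_cases hp : (⟨(i, j), h⟩ : {p : Fin n × Fin n // p.1 < p.2}) = p
    · subst hp; simp [unitriMatrix, h]
    · have hp' : ¬(p.1.1 = i ∧ p.1.2 = j) := fun e => hp (Subtype.ext (Prod.ext e.1.symm e.2.symm))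
      simp [unitriMatrix, h, hp, hp']
  · have hp' : ¬(p.1.1 = i ∧ p.1.2 = j) := fun e => h (e.1 ▸ e.2 ▸ p.2)
    simp [unitriMatrix, h, hp']

/-- Since A⁻¹ is upper triangular and i < j, E A⁻¹ E = 0 for the matrix unit E, so the Neumann
series stops after its linear term. This is why the factors are affine in each entry of A although
they contain A⁻¹. -/
theorem IsUnitri.inv_add_smul_single {A : Matrix (Fin n) (Fin n) ℂ} (hA : IsUnitri A) {i j : Fin n}
    (hij : i < j) (t : ℂ) :
    (A + t • Matrix.single i j 1)⁻¹ = A⁻¹ + t • -(A⁻¹ * Matrix.single i j 1 * A⁻¹) := by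
  apply Matrix.inv_eq_right_inv
  have h1 : Matrix.single i j (1 : ℂ) * A⁻¹ * Matrix.single i j 1 = 0 := by
    rw [Matrix.single_mul_mul_single, hA.inv.1 j i hij]
    simp
  have h2 : A * A⁻¹ = 1 := Matrix.mul_nonsing_inv _ hA.isUnit_det
  calc (A + t • Matrix.single i j (1 : ℂ)) *
        (A⁻¹ + t • -(A⁻¹ * Matrix.single i j (1 : ℂ) * A⁻¹))
      = A * A⁻¹ + t • (Matrix.single i j (1 : ℂ) * A⁻¹ -
          (A * A⁻¹) * Matrix.single i j (1 : ℂ) * A⁻¹) -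
          (t * t) • (Matrix.single i j (1 : ℂ) * A⁻¹ * Matrix.single i j (1 : ℂ) * A⁻¹) := by
        simp only [Matrix.mul_assoc, add_mul, mul_add, smul_mul_assoc, mul_smul_comm, smul_neg,
          mul_neg, smul_sub, smul_add, mul_smul]
        abel
    _ = 1 := by rw [h1, h2]; simp

theorem exists_stepMat_add_smul (s : Bool) (y : UnitriCoord n × SymCoord n)
    (b : {p : Fin n × Fin n // p.1 < p.2} ⊕ Sym2 (Fin n)) :
    ∃ D, ∀ t : ℂ, stepMat s (y + t • blockDir b) = stepMat s y + t • D := by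
  have hA := isUnitri_unitriMatrix y.1
  rcases b with p | w
  · set S : Matrix (Fin n) (Fin n) ℂ := Matrix.single p.1.1 p.1.2 1
    set S' := -((unitriMatrix y.1)⁻¹ * S * (unitriMatrix y.1)⁻¹)
    have h1 : ∀ t : ℂ, unitriMatrix (y + t • blockDir (Sum.inl p)).1 = unitriMatrix y.1 + t • S :=
      fun t => unitriMatrix_add_smul_single y.1 p t
    have h2 : ∀ t : ℂ, (unitriMatrix (y + t • blockDir (Sum.inl p)).1)⁻¹ =
        (unitriMatrix y.1)⁻¹ + t • S' := fun t => by
      rw [h1]; exact hA.inv_add_smul_single p.2 t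
    have h3 : ∀ t : ℂ, (y + t • blockDir (Sum.inl p)).2 = y.2 := fun t => by simp [blockDir]
    cases s
    · refine ⟨Matrix.fromBlocks S' (symMatrix y.2 * Sᵀ) 0 Sᵀ, fun t => ?_⟩
      change elemPlus _ _ = elemPlus _ _ + _
      rw [elemPlus_eq, elemPlus_eq, h2, h1, h3, Matrix.fromBlocks_smul, Matrix.fromBlocks_add]
      simp [mul_add]
    · refine ⟨Matrix.fromBlocks S'ᵀ 0 (symMatrix y.2 * S'ᵀ) S, fun t => ?_⟩
      change elemMinus _ _ = elemMinus _ _ + _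
      rw [elemMinus_eq, elemMinus_eq, h2, h1, h3, Matrix.fromBlocks_smul, Matrix.fromBlocks_add]
      simp [mul_add]
  · have h1 : ∀ t : ℂ, (y + t • blockDir (Sum.inr w)).1 = y.1 := fun t => by simp [blockDir]
    have h2 : ∀ t : ℂ, symMatrix (y + t • blockDir (Sum.inr w)).2 =
        symMatrix y.2 + t • symMatrix (Pi.single w 1) := fun t => by
      ext i j; simp [symMatrix, blockDir]
    cases s
    · refine ⟨Matrix.fromBlocks 0 (symMatrix (Pi.single w 1) * (unitriMatrix y.1)ᵀ) 0 0,
        fun t => ?_⟩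
      change elemPlus _ _ = elemPlus _ _ + _
      rw [elemPlus_eq, elemPlus_eq, h2, h1, Matrix.fromBlocks_smul, Matrix.fromBlocks_add]
      simp [add_mul]
    · refine ⟨Matrix.fromBlocks 0 0 (symMatrix (Pi.single w 1) * ((unitriMatrix y.1)⁻¹)ᵀ) 0,
        fun t => ?_⟩
      change elemMinus _ _ = elemMinus _ _ + _
      rw [elemMinus_eq, elemMinus_eq, h2, h1, Matrix.fromBlocks_smul, Matrix.fromBlocks_add]
      simp [add_mul]

theorem stepMat_add_smul (s : Bool) (y : UnitriCoord n × SymCoord n)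
    (b : {p : Fin n × Fin n // p.1 < p.2} ⊕ Sym2 (Fin n)) (t : ℂ) :
    stepMat s (y + t • blockDir b) =
      stepMat s y + t • (stepMat s (y + blockDir b) - stepMat s y) := by
  obtain ⟨D, hD⟩ := exists_stepMat_add_smul s y b
  have h := hD 1
  rw [one_smul, one_smul] at h
  rw [hD, h, add_sub_cancel_left]

theorem span_range_blockDir :
    Submodule.span ℂ (Set.range (blockDir (n := n))) = ⊤ := by
  rw [eq_top_iff]
  rintro ⟨a, z⟩ -
  have h : ((a, z) : UnitriCoord n × SymCoord n) =
      ∑ p, a p • blockDir (Sum.inl p) + ∑ w, z w • blockDir (Sum.inr w) := by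
    refine Prod.ext ?_ ?_
    · ext p
      simp [blockDir, Prod.fst_sum, Finset.sum_apply, Pi.single_apply]
    · ext w
      simp [blockDir, Prod.snd_sum, Finset.sum_apply, Pi.single_apply]
  rw [h]
  exact Submodule.add_mem _
    (Submodule.sum_mem _ fun p _ => Submodule.smul_mem _ _ (Submodule.subset_span ⟨_, rfl⟩))
    (Submodule.sum_mem _ fun w _ => Submodule.smul_mem _ _ (Submodule.subset_span ⟨_, rfl⟩))

end Directions

/-! ### Critical pairs -/

section Critical

variable {n : ℕ}

/-- The pairing of the row `u` with the column `c` vanishes on the Lie algebra of the group of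
factors of sign `-`. -/
def IsCritPair (u c : Fin n ⊕ Fin n → ℂ) : Prop :=
  (∀ i j, u (Sum.inr i) * c (Sum.inl j) + u (Sum.inr j) * c (Sum.inl i) = 0) ∧
    ∀ i j, i < j → u (Sum.inr i) * c (Sum.inr j) - u (Sum.inl j) * c (Sum.inl i) = 0

/-- A holomorphic curve through the identity in the group of factors of sign `-` which acts
affinely, with derivative `κ` of the pairing. -/
structure IsAffineCurve (C W : ℂ → Matrix (Fin n) (Fin n) ℂ)
    (κ : (Fin n ⊕ Fin n → ℂ) → (Fin n ⊕ Fin n → ℂ) → ℂ) : Prop where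
  analytic_left : EntryAnalytic C 0
  analytic_right : EntryAnalytic W 0
  isUnitri : ∀ t, IsUnitri (C t)
  symm : ∀ t, (W t)ᵀ = W t
  left_zero : C 0 = 1
  right_zero : W 0 = 0
  pairing : ∀ t u c, (u ᵥ* elemMinus (C t) (W t)) ⬝ᵥ c = u ⬝ᵥ c + t * κ u c

theorem vecMul_single_dotProduct (a b : Fin n → ℂ) (i j : Fin n) :
    (a ᵥ* Matrix.single i j 1) ⬝ᵥ b = a i * b j := by
  rw [Matrix.single_eq_single_vecMulVec_single, Matrix.vecMul_vecMulVec]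
  simp

/-- The one-parameter groups of the symmetric generators; together with those of `isAffineCurve_tri`
they yield all the equations of `IsCritPair`. -/
theorem isAffineCurve_symm (i j : Fin n) :
    IsAffineCurve (fun _ => 1)
      (fun t => t • (Matrix.single i j (1 : ℂ) + Matrix.single j i 1))
      (fun u c => u (Sum.inr i) * c (Sum.inl j) + u (Sum.inr j) * c (Sum.inl i)) where
  analytic_left := EntryAnalytic.const 1 0
  analytic_right := EntryAnalytic.smul analyticAt_id (EntryAnalytic.const _ 0)
  isUnitri := fun _ => isUnitri_one
  symm := fun t => by
    rw [Matrix.transpose_smul, Matrix.transpose_add, Matrix.transpose_single,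
      Matrix.transpose_single, add_comm]
  left_zero := rfl
  right_zero := zero_smul _ _
  pairing := fun t u c => by
    rw [elemMinus_eq, Matrix.vecMul_fromBlocks, ← Sum.elim_comp_inl_inr c,
      sumElim_dotProduct_sumElim]
    conv_rhs => rw [← Sum.elim_comp_inl_inr u, sumElim_dotProduct_sumElim]
    simp only [inv_one, Matrix.transpose_one, Matrix.vecMul_one, mul_one, Matrix.vecMul_zero,
      zero_add, Matrix.vecMul_smul, Matrix.vecMul_add, add_dotProduct, smul_dotProduct,
      vecMul_single_dotProduct, smul_eq_mul]
    simp
    ring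

theorem isAffineCurve_tri {i j : Fin n} (hij : i < j) :
    IsAffineCurve (fun t => 1 + t • Matrix.single i j (1 : ℂ)) (fun _ => 0)
      (fun u c => u (Sum.inr i) * c (Sum.inr j) - u (Sum.inl j) * c (Sum.inl i)) where
  analytic_left := (EntryAnalytic.const 1 0).add
    (EntryAnalytic.smul analyticAt_id (EntryAnalytic.const _ 0))
  analytic_right := EntryAnalytic.const 0 0
  isUnitri := fun t => by
    refine ⟨fun a b h => ?_, fun a => ?_⟩
    · have : ¬(i = a ∧ j = b) := by rintro ⟨rfl, rfl⟩; exact lt_asymm h hij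
      simp [Matrix.one_apply_ne h.ne', this]
    · have : ¬(i = a ∧ j = a) := by rintro ⟨rfl, rfl⟩; exact lt_irrefl _ hij
      simp [this]
  symm := fun _ => Matrix.transpose_zero
  left_zero := by simp
  right_zero := rfl
  pairing := fun t u c => by
    rw [elemMinus_eq, isUnitri_one.inv_add_smul_single hij, Matrix.vecMul_fromBlocks,
      ← Sum.elim_comp_inl_inr c, sumElim_dotProduct_sumElim]
    conv_rhs => rw [← Sum.elim_comp_inl_inr u, sumElim_dotProduct_sumElim]
    simp only [inv_one, Matrix.transpose_one, Matrix.vecMul_one, mul_one, one_mul,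
      Matrix.vecMul_zero, zero_mul, zero_add, add_zero, Matrix.vecMul_smul, Matrix.vecMul_add,
      Matrix.transpose_add, Matrix.transpose_smul, Matrix.transpose_neg, Matrix.transpose_single,
      Matrix.vecMul_neg, add_dotProduct, smul_dotProduct, neg_dotProduct, vecMul_single_dotProduct,
      smul_eq_mul]
    simp
    ring

/-! ### Critical factors and translations in their group -/

section

variable {s : Bool} {y : UnitriCoord n × SymCoord n} {r c : Fin n ⊕ Fin n → ℂ}

/-- Chain rule along a curve of parameters on which the pairing is affine with slope κ. -/
theorem eq_zero_of_hasFDerivAt_zero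
    (h : HasFDerivAt (fun y => (r ᵥ* stepMat s y) ⬝ᵥ c) (0 : _ →L[ℂ] ℂ) y)
    {A Z : ℂ → Matrix (Fin n) (Fin n) ℂ} (hA : EntryAnalytic A 0) (hZ : EntryAnalytic Z 0)
    (hAt : ∀ t, IsUnitri (A t)) (hZt : ∀ t, (Z t)ᵀ = Z t) (hA0 : A 0 = stepTri s y)
    (hZ0 : Z 0 = symMatrix y.2) {κ₀ κ : ℂ}
    (hκ : ∀ t, ((r ∘ signSwap s) ᵥ* elemMinus (A t) (Z t)) ⬝ᵥ (c ∘ signSwap s) = κ₀ + t * κ) :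
    κ = 0 := by
  have h0 : stepCoord s (A 0) (Z 0) = y := by rw [hA0, hZ0, stepCoord_stepTri]
  have hγ : HasDerivAt (fun t => stepCoord s (A t) (Z t))
      (deriv (fun t => stepCoord s (A t) (Z t)) 0) 0 :=
    (EntryAnalytic.stepCoord s hA (hAt 0) hZ).differentiableAt.hasDerivAt
  have h1 := HasFDerivAt.comp_hasDerivAt (0 : ℂ) (by rw [h0]; exact h) hγ
  have h2 : ((fun y => (r ᵥ* stepMat s y) ⬝ᵥ c) ∘ fun t => stepCoord s (A t) (Z t)) =
      fun t => κ₀ + t * κ := by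
    ext t
    rw [Function.comp_apply, stepMat_stepCoord s (hAt t) (hZt t), vecMul_signConj_dotProduct, hκ]
  rw [h2] at h1
  have h3 : HasDerivAt (fun t : ℂ => κ₀ + t * κ) κ 0 := by
    simpa using ((hasDerivAt_id (0 : ℂ)).mul_const κ).const_add κ₀
  exact (h1.unique h3).symm

theorem vecMul_comp_signSwap (s : Bool) (y : UnitriCoord n × SymCoord n) (r : Fin n ⊕ Fin n → ℂ) :
    (r ᵥ* stepMat s y) ∘ signSwap s =
      (r ∘ signSwap s) ᵥ* elemMinus (stepTri s y) (symMatrix y.2) := by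
  ext l
  rw [Function.comp_apply, stepMat_eq, vecMul_signConj, signSwap_signSwap]

theorem mulVec_comp_signSwap (s : Bool) (y : UnitriCoord n × SymCoord n) (c : Fin n ⊕ Fin n → ℂ) :
    (stepMat s y *ᵥ c) ∘ signSwap s =
      elemMinus (stepTri s y) (symMatrix y.2) *ᵥ (c ∘ signSwap s) := by
  ext l
  rw [Function.comp_apply, stepMat_eq, signConj_mulVec, signSwap_signSwap]

theorem IsAffineCurve.right_eq_zero {C W : ℂ → Matrix (Fin n) (Fin n) ℂ}
    {κ : (Fin n ⊕ Fin n → ℂ) → (Fin n ⊕ Fin n → ℂ) → ℂ} (hC : IsAffineCurve C W κ)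
    (h : HasFDerivAt (fun y => (r ᵥ* stepMat s y) ⬝ᵥ c) (0 : _ →L[ℂ] ℂ) y) :
    κ ((r ᵥ* stepMat s y) ∘ signSwap s) (c ∘ signSwap s) = 0 := by
  have hA := isUnitri_stepTri s y
  have hAc := EntryAnalytic.const (stepTri s y) (0 : ℂ)
  refine eq_zero_of_hasFDerivAt_zero h (A := fun t => stepTri s y * C t)
    (Z := fun t => symMatrix y.2 + stepTri s y * W t * (stepTri s y)ᵀ)
    (hAc.mul hC.analytic_left)
    ((EntryAnalytic.const _ _).add ((hAc.mul hC.analytic_right).mul hAc.transpose))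
    (fun t => hA.mul (hC.isUnitri t)) (fun t => ?_) ?_ ?_
    (κ₀ := ((r ᵥ* stepMat s y) ∘ signSwap s) ⬝ᵥ (c ∘ signSwap s)) (fun t => ?_)
  · rw [Matrix.transpose_add, symMatrix_transpose, Matrix.transpose_mul, Matrix.transpose_mul,
      hC.symm, Matrix.transpose_transpose, Matrix.mul_assoc]
  · rw [hC.left_zero, mul_one]
  · rw [hC.right_zero, mul_zero, zero_mul, add_zero]
  · rw [← elemMinus_mul hA, ← Matrix.vecMul_vecMul, ← vecMul_comp_signSwap, hC.pairing]

theorem IsAffineCurve.left_eq_zero {C W : ℂ → Matrix (Fin n) (Fin n) ℂ}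
    {κ : (Fin n ⊕ Fin n → ℂ) → (Fin n ⊕ Fin n → ℂ) → ℂ} (hC : IsAffineCurve C W κ)
    (h : HasFDerivAt (fun y => (r ᵥ* stepMat s y) ⬝ᵥ c) (0 : _ →L[ℂ] ℂ) y) :
    κ (r ∘ signSwap s) ((stepMat s y *ᵥ c) ∘ signSwap s) = 0 := by
  have hA := isUnitri_stepTri s y
  refine eq_zero_of_hasFDerivAt_zero h (A := fun t => C t * stepTri s y)
    (Z := fun t => W t + C t * symMatrix y.2 * (C t)ᵀ)
    (hC.analytic_left.mul (EntryAnalytic.const _ _))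
    (hC.analytic_right.add ((hC.analytic_left.mul (EntryAnalytic.const _ _)).mul
      hC.analytic_left.transpose))
    (fun t => (hC.isUnitri t).mul hA) (fun t => ?_) ?_ ?_
    (κ₀ := (r ∘ signSwap s) ⬝ᵥ ((stepMat s y *ᵥ c) ∘ signSwap s)) (fun t => ?_)
  · rw [Matrix.transpose_add, hC.symm, Matrix.transpose_mul, Matrix.transpose_mul,
      symMatrix_transpose, Matrix.transpose_transpose, Matrix.mul_assoc]
  · rw [hC.left_zero, one_mul]
  · rw [hC.left_zero, hC.right_zero, one_mul, Matrix.transpose_one, mul_one, zero_add]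
  · rw [← elemMinus_mul (hC.isUnitri t), ← Matrix.vecMul_vecMul, ← Matrix.dotProduct_mulVec,
      ← mulVec_comp_signSwap, hC.pairing]

/-- Multiplying the factor on the right by the affine curves tests the row behind the factor against
c. -/
theorem isCritPair_right
    (h : HasFDerivAt (fun y => (r ᵥ* stepMat s y) ⬝ᵥ c) (0 : _ →L[ℂ] ℂ) y) :
    IsCritPair ((r ᵥ* stepMat s y) ∘ signSwap s) (c ∘ signSwap s) :=
  ⟨fun i j => (isAffineCurve_symm i j).right_eq_zero h,
    fun _ _ hij => (isAffineCurve_tri hij).right_eq_zero h⟩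

/-- Multiplying on the left instead tests the row in front of the factor against the column to which
the factor has been applied. -/
theorem isCritPair_left
    (h : HasFDerivAt (fun y => (r ᵥ* stepMat s y) ⬝ᵥ c) (0 : _ →L[ℂ] ℂ) y) :
    IsCritPair (r ∘ signSwap s) ((stepMat s y *ᵥ c) ∘ signSwap s) :=
  ⟨fun i j => (isAffineCurve_symm i j).left_eq_zero h,
    fun _ _ hij => (isAffineCurve_tri hij).left_eq_zero h⟩

end

/-- The last standard basis row vector. -/
abbrev baseRow (n : ℕ) : Fin n ⊕ Fin n → ℂ := Sum.elim 0 (lastVec n)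

theorem lastVec_vecMul_symMatrix (z : SymCoord n) :
    lastVec n ᵥ* symMatrix z = symMatrix z *ᵥ lastVec n := by
  conv_lhs => rw [← symMatrix_transpose, Matrix.vecMul_transpose]

theorem lastVec_vecMul_plus (A Z : Matrix (Fin n) (Fin n) ℂ) :
    baseRow n ᵥ* elemPlus A Z = Sum.elim (0 : Fin n → ℂ) (A *ᵥ lastVec n) := by
  rw [elemPlus_eq, Matrix.vecMul_fromBlocks, Sum.elim_comp_inl, Sum.elim_comp_inr,
    Matrix.vecMul_transpose]
  simp

theorem minus_mulVec_lastVec (A Z : Matrix (Fin n) (Fin n) ℂ) :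
    elemMinus A Z *ᵥ baseRow n = Sum.elim (0 : Fin n → ℂ) (A *ᵥ lastVec n) := by
  rw [elemMinus_eq, Matrix.fromBlocks_mulVec, Sum.elim_comp_inl, Sum.elim_comp_inr]
  simp

/-- The last index. -/
def lastIdx (n : ℕ) [NeZero n] : Fin n := ⟨n - 1, Nat.sub_lt (NeZero.pos n) one_pos⟩

variable [NeZero n]

theorem lt_lastIdx {i : Fin n} (h : i ≠ lastIdx n) : i < lastIdx n := by
  have h' : (i : ℕ) ≠ n - 1 := fun e => h (Fin.ext e)
  rw [Fin.lt_def]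
  simp only [lastIdx]
  omega

theorem lastVec_eq : lastVec n = Pi.single (lastIdx n) 1 := by
  ext i
  have hn := NeZero.pos n
  by_cases h : i = lastIdx n
  · subst h
    have : n - 1 + 1 = n := by omega
    simp [lastVec, lastIdx, this]
  · have h' : (i : ℕ) + 1 ≠ n := fun e => h (Fin.ext (by simp only [lastIdx]; omega))
    simp [lastVec, h, h']

theorem baseRow_eq : baseRow n = Pi.single (Sum.inr (lastIdx n)) 1 := by
  rw [baseRow, lastVec_eq]
  ext (i | i)
  · simp
  · by_cases h : i = lastIdx n <;> simp [h]

/-- A pair that is critical for both signs, whose row has last coordinate `1`. -/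
theorem eq_single_of_isCritPair {u c : Fin n ⊕ Fin n → ℂ} (hu : u (Sum.inr (lastIdx n)) = 1)
    (hc : c ≠ 0) {s : Bool} (h₁ : IsCritPair (u ∘ signSwap s) (c ∘ signSwap s))
    (h₂ : IsCritPair (u ∘ signSwap (!s)) (c ∘ signSwap (!s))) :
    u = Pi.single (Sum.inr (lastIdx n)) 1 ∧
      c = c (Sum.inr (lastIdx n)) • Pi.single (Sum.inr (lastIdx n)) 1 ∧
      c (Sum.inr (lastIdx n)) ≠ 0 := by
  have hm : IsCritPair u c := by cases s; exacts [h₂, h₁]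
  have hp : IsCritPair (u ∘ Sum.swap) (c ∘ Sum.swap) := by cases s; exacts [h₁, h₂]
  -- With u = 1 in the last coordinate, the symmetric generators of sign - kill the first half of c
  -- and the triangular ones of sign + kill the second half except its last entry. That entry is
  -- nonzero because c is, and it then plays the same role in killing the coordinates of u.
  have hc1 : ∀ i, c (Sum.inl i) = 0 := by
    have h := hm.1 (lastIdx n) (lastIdx n)
    rw [hu, one_mul, ← two_mul] at h
    have h0 : c (Sum.inl (lastIdx n)) = 0 := by simpa using h
    intro i
    have h' := hm.1 (lastIdx n) i
    rwa [hu, h0, mul_zero, one_mul, add_zero] at h'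
  have hc2 : ∀ i, i ≠ lastIdx n → c (Sum.inr i) = 0 := by
    intro i hi
    have h := hp.2 i (lastIdx n) (lt_lastIdx hi)
    simpa [hc1, hu] using h
  have hcl : c (Sum.inr (lastIdx n)) ≠ 0 := by
    intro h0
    refine hc (funext ?_)
    rintro (i | i)
    · exact hc1 i
    · by_cases hi : i = lastIdx n
      · rw [hi]; exact h0
      · exact hc2 i hi
  refine ⟨funext ?_, funext ?_, hcl⟩
  · have h := hp.1 (lastIdx n) (lastIdx n)
    have h0 : u (Sum.inl (lastIdx n)) = 0 := by
      rw [← two_mul] at h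
      simpa [hcl] using h
    rintro (i | i)
    · have h' := hp.1 i (lastIdx n)
      simpa [h0, hcl] using h'
    · by_cases hi : i = lastIdx n
      · rw [hi, hu]; simp
      · have h' := hm.2 i (lastIdx n) (lt_lastIdx hi)
        have h'' : u (Sum.inr i) = 0 := by simpa [hc1, hcl] using h'
        simp [h'', hi]
  · rintro (i | i)
    · simp [hc1 i]
    · by_cases hi : i = lastIdx n
      · subst hi; simp
      · simp [hc2 i hi, hi]

/-! ### Factors fixing the last vector -/

section Fix

variable (s : Bool) (y : UnitriCoord n × SymCoord n)

theorem unitri_transpose_mulVec_last (A : Matrix (Fin n) (Fin n) ℂ) (hA : IsUnitri A) :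
    Aᵀ *ᵥ lastVec n = lastVec n := by
  rw [lastVec_eq, Matrix.mulVec_single_one]
  ext i
  by_cases h : i = lastIdx n
  · subst h; simp [hA.2]
  · simp [h, hA.1 _ _ (lt_lastIdx h)]

theorem lastVec_vecMul_minus (A Z : Matrix (Fin n) (Fin n) ℂ) (hA : IsUnitri A) :
    baseRow n ᵥ* elemMinus A Z =
      Sum.elim ((lastVec n ᵥ* Z) ᵥ* (A⁻¹)ᵀ) (lastVec n) := by
  have h := unitri_transpose_mulVec_last A hA
  rw [Matrix.mulVec_transpose] at h
  rw [elemMinus_eq, Matrix.vecMul_fromBlocks, Sum.elim_comp_inl, Sum.elim_comp_inr, h]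
  simp

theorem plus_mulVec_lastVec (A Z : Matrix (Fin n) (Fin n) ℂ) (hA : IsUnitri A) :
    elemPlus A Z *ᵥ baseRow n = Sum.elim (Z *ᵥ lastVec n) (lastVec n) := by
  rw [elemPlus_eq, Matrix.fromBlocks_mulVec, Sum.elim_comp_inl, Sum.elim_comp_inr,
    ← Matrix.mulVec_mulVec, unitri_transpose_mulVec_last A hA]
  simp

/-- The last row of A is that of the identity, so A is not constrained. This is why the first factor
contributes no condition on A₁ to `singSet`. -/
theorem lastVec_vecMul_stepMat_true_iff :
    baseRow n ᵥ* stepMat true y = baseRow n ↔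
      symMatrix y.2 *ᵥ lastVec n = 0 := by
  have hA := isUnitri_unitriMatrix y.1
  change baseRow n ᵥ* elemMinus _ _ = _ ↔ _
  rw [lastVec_vecMul_minus _ _ hA, lastVec_vecMul_symMatrix]
  constructor
  · intro h
    have h1 : (symMatrix y.2 *ᵥ lastVec n) ᵥ* ((unitriMatrix y.1)⁻¹)ᵀ = 0 :=
      funext fun i => congrFun h (Sum.inl i)
    have h2 := congrArg (· ᵥ* (unitriMatrix y.1)ᵀ) h1
    simp only [Matrix.vecMul_vecMul, Matrix.zero_vecMul] at h2
    rwa [← Matrix.transpose_mul, Matrix.mul_nonsing_inv _ hA.isUnit_det, Matrix.transpose_one,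
      Matrix.vecMul_one] at h2
  · intro h
    rw [h, Matrix.zero_vecMul]

/-- For the sign - the row condition expresses Z eₙ = 0 and the column condition A eₙ = eₙ; for the
sign + the two are interchanged. The equations of `singSet` for the middle factors thus do not
depend on the sign. -/
theorem stepMat_fix_iff :
    (baseRow n ᵥ* stepMat s y = baseRow n ∧
      stepMat s y *ᵥ baseRow n = baseRow n) ↔
    (symMatrix y.2 *ᵥ lastVec n = 0 ∧ unitriMatrix y.1 *ᵥ lastVec n = lastVec n) := by
  have hA := isUnitri_unitriMatrix y.1
  cases s
  · change (_ ᵥ* elemPlus _ _ = _ ∧ elemPlus _ _ *ᵥ _ = _) ↔ _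
    rw [lastVec_vecMul_plus, plus_mulVec_lastVec _ _ hA]
    constructor
    · rintro ⟨h1, h2⟩
      exact ⟨funext fun i => congrFun h2 (Sum.inl i), funext fun i => congrFun h1 (Sum.inr i)⟩
    · rintro ⟨h1, h2⟩
      rw [h1, h2]
      exact ⟨rfl, rfl⟩
  · rw [lastVec_vecMul_stepMat_true_iff]
    change (_ ∧ elemMinus _ _ *ᵥ _ = _) ↔ _
    rw [minus_mulVec_lastVec]
    constructor
    · rintro ⟨h1, h2⟩
      exact ⟨h1, funext fun i => congrFun h2 (Sum.inr i)⟩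
    · rintro ⟨h1, h2⟩
      rw [h2]
      exact ⟨h1, rfl⟩

theorem lastVec_vecMul_stepMat_apply :
    (baseRow n ᵥ* stepMat s y) (Sum.inr (lastIdx n)) = 1 := by
  have hA := isUnitri_unitriMatrix y.1
  cases s
  · change (_ ᵥ* elemPlus _ _) _ = _
    rw [lastVec_vecMul_plus, Sum.elim_inr, lastVec_eq, Matrix.mulVec_single_one]
    exact hA.2 _
  · change (_ ᵥ* elemMinus _ _) _ = _
    rw [lastVec_vecMul_minus _ _ hA, Sum.elim_inr, lastVec_eq]
    simp

end Fix

end Critical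

/-! ### Chains of rows and columns -/

section Chain

variable {n : ℕ}

/-- The sign of the factor with index `k`. -/
def stepSign (k : ℕ) : Bool := decide (Even k)

theorem stepSign_succ (k : ℕ) : stepSign (k + 1) = !stepSign k := by
  simp only [stepSign, Nat.even_add_one, decide_not]

/-- The last row of the product of the first `k` factors. -/
noncomputable def rowAt (X : ℕ → UnitriCoord n × SymCoord n) : ℕ → Fin n ⊕ Fin n → ℂ
  | 0 => baseRow n
  | k + 1 => rowAt X k ᵥ* stepMat (stepSign k) (X k)

/-- The product of the `j` factors from index `k` on, applied to the column `c`. -/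
noncomputable def colAt (X : ℕ → UnitriCoord n × SymCoord n) (c : Fin n ⊕ Fin n → ℂ) :
    ℕ → ℕ → Fin n ⊕ Fin n → ℂ
  | 0, _ => c
  | j + 1, k => stepMat (stepSign k) (X k) *ᵥ colAt X c j (k + 1)

theorem rowAt_add_dotProduct (X : ℕ → UnitriCoord n × SymCoord n) (c : Fin n ⊕ Fin n → ℂ)
    (j k : ℕ) : rowAt X (k + j) ⬝ᵥ c = rowAt X k ⬝ᵥ colAt X c j k := by
  induction j generalizing k with
  | zero => rfl
  | succ j ih =>
    have h := ih (k + 1)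
    rw [rowAt, ← Matrix.dotProduct_mulVec] at h
    rw [colAt, ← h, Nat.add_right_comm, Nat.add_assoc]

theorem rowAt_congr {X X' : ℕ → UnitriCoord n × SymCoord n} {k : ℕ} (h : ∀ i < k, X i = X' i) :
    rowAt X k = rowAt X' k := by
  induction k with
  | zero => rfl
  | succ k ih => rw [rowAt, rowAt, ih fun i hi => h i (by omega), h k (by omega)]

theorem colAt_congr {X X' : ℕ → UnitriCoord n × SymCoord n} (c : Fin n ⊕ Fin n → ℂ) {j k : ℕ}
    (h : ∀ i, k ≤ i → X i = X' i) : colAt X c j k = colAt X' c j k := by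
  induction j generalizing k with
  | zero => rfl
  | succ j ih => rw [colAt, colAt, ih fun i hi => h i (by omega), h k le_rfl]

theorem rowAt_update_dotProduct (X : ℕ → UnitriCoord n × SymCoord n) (c : Fin n ⊕ Fin n → ℂ)
    (k j : ℕ) (y : UnitriCoord n × SymCoord n) :
    rowAt (Function.update X k y) (k + 1 + j) ⬝ᵥ c =
      (rowAt X k ᵥ* stepMat (stepSign k) y) ⬝ᵥ colAt X c j (k + 1) := by
  rw [rowAt_add_dotProduct, rowAt, Function.update_self,
    rowAt_congr (X' := X) fun i hi => Function.update_of_ne hi.ne _ _,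
    colAt_congr (X' := X) c fun i hi => Function.update_of_ne (by omega) _ _]

theorem vecMul_stepMat_ne_zero {s : Bool} {y : UnitriCoord n × SymCoord n}
    {u : Fin n ⊕ Fin n → ℂ} (hu : u ≠ 0) : u ᵥ* stepMat s y ≠ 0 := by
  intro h
  have h1 := congrArg (· ᵥ* stepInv s y) h
  simp only [Matrix.vecMul_vecMul, stepMat_mul_stepInv, Matrix.vecMul_one,
    Matrix.zero_vecMul] at h1
  exact hu h1

theorem colAt_ne_zero (X : ℕ → UnitriCoord n × SymCoord n) {c : Fin n ⊕ Fin n → ℂ} (hc : c ≠ 0)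
    (j k : ℕ) : colAt X c j k ≠ 0 := by
  induction j generalizing k with
  | zero => exact hc
  | succ j ih =>
    intro h
    have h1 := congrArg (stepInv (stepSign k) (X k) *ᵥ ·) h
    simp only [colAt, Matrix.mulVec_mulVec, stepInv_mul_stepMat, Matrix.one_mulVec,
      Matrix.mulVec_zero] at h1
    exact ih (k + 1) h1

theorem baseRow_ne_zero [NeZero n] : baseRow n ≠ 0 := by
  intro h
  have := congrFun h (Sum.inr (lastIdx n))
  rw [baseRow_eq] at this
  simp at this

theorem rowAt_ne_zero [NeZero n] (X : ℕ → UnitriCoord n × SymCoord n) (k : ℕ) :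
    rowAt X k ≠ 0 := by
  induction k with
  | zero => exact baseRow_ne_zero
  | succ k ih => exact vecMul_stepMat_ne_zero ih

/-- If the pairing of the final row with `c` is critical, all intermediate rows and columns are
multiples of the last basis vector. -/
theorem rowAt_eq_of_critical [NeZero n] {X : ℕ → UnitriCoord n × SymCoord n}
    {c : Fin n ⊕ Fin n → ℂ} (hc : c ≠ 0) {K : ℕ}
    (h : ∀ k j, k + 1 + j = K → HasFDerivAt (fun y => (rowAt X k ᵥ* stepMat (stepSign k) y) ⬝ᵥ
      colAt X c j (k + 1)) (0 : _ →L[ℂ] ℂ) (X k)) (k j : ℕ) (hk : k + 1 + (j + 1) = K) :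
    rowAt X (k + 1) = baseRow n ∧
      ∃ γ : ℂ, γ ≠ 0 ∧ colAt X c (j + 1) (k + 1) = γ • baseRow n := by
  have hrow : rowAt X k = baseRow n := by
    induction k generalizing j with
    | zero => rfl
    | succ k ih =>
      have hcol := colAt_ne_zero X hc (j + 1 + 1) (k + 1)
      -- The same row and column sit behind factor k and in front of factor k + 1, which has the
      -- opposite sign, so the pair is critical for both signs.
      have h1 := isCritPair_right (h k (j + 1 + 1) (by omega))
      have h2 := isCritPair_left (h (k + 1) (j + 1) (by omega))
      rw [stepSign_succ] at h2
      have h3 := ih (j + 1) (by omega)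
      refine (eq_single_of_isCritPair ?_ hcol h1 (by
        rw [colAt, stepSign_succ]; exact h2)).1.trans baseRow_eq.symm
      rw [h3]
      exact lastVec_vecMul_stepMat_apply _ _
  have hcol := colAt_ne_zero X hc (j + 1) (k + 1)
  have h1 := isCritPair_right (h k (j + 1) (by omega))
  have h2 := isCritPair_left (h (k + 1) j (by omega))
  rw [stepSign_succ] at h2
  obtain ⟨h4, h5, h6⟩ := eq_single_of_isCritPair
    (by rw [hrow]; exact lastVec_vecMul_stepMat_apply _ _) hcol h1
    (by rw [colAt, stepSign_succ]; exact h2)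
  rw [baseRow_eq]
  exact ⟨h4, _, h6, h5⟩

/-- A critical pairing forces all factors except the first and the last to fix the last basis
vector. -/
theorem fix_of_critical [NeZero n] {X : ℕ → UnitriCoord n × SymCoord n}
    {c : Fin n ⊕ Fin n → ℂ} (hc : c ≠ 0) {K : ℕ}
    (h : ∀ k j, k + 1 + j = K → HasFDerivAt (fun y => (rowAt X k ᵥ* stepMat (stepSign k) y) ⬝ᵥ
      colAt X c j (k + 1)) (0 : _ →L[ℂ] ℂ) (X k)) (k : ℕ) (hk0 : 0 < k) (hk : k + 1 < K) :
    baseRow n ᵥ* stepMat (stepSign k) (X k) = baseRow n ∧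
      stepMat (stepSign k) (X k) *ᵥ baseRow n = baseRow n := by
  obtain ⟨k, rfl⟩ : ∃ k', k = k' + 1 := ⟨k - 1, by omega⟩
  obtain ⟨j, rfl⟩ : ∃ j, K = k + 1 + 1 + (j + 1) := ⟨K - (k + 3), by omega⟩
  obtain ⟨h1, γ, hγ, h2⟩ := rowAt_eq_of_critical hc h k (j + 1) (by omega)
  obtain ⟨h3, δ, hδ, h4⟩ := rowAt_eq_of_critical hc h (k + 1) j (by omega)
  rw [rowAt, h1] at h3
  refine ⟨h3, ?_⟩
  rw [colAt, h4, Matrix.mulVec_smul] at h2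
  -- The columns at the two neighbouring junctions only show that the basis column is an
  -- eigenvector. Pairing with the basis row, which the factor fixes, shows that the eigenvalue is
  -- 1.
  have h5 : stepMat (stepSign (k + 1)) (X (k + 1)) *ᵥ baseRow n = (δ⁻¹ * γ) • baseRow n := by
    rw [mul_smul, ← h2, smul_smul, inv_mul_cancel₀ hδ, one_smul]
  have h6 : baseRow n ⬝ᵥ baseRow n = 1 := by rw [baseRow_eq]; simp
  have h7 := congrArg (baseRow n ⬝ᵥ ·) h5
  simp only [Matrix.dotProduct_mulVec, h3, dotProduct_smul, h6, smul_eq_mul, mul_one] at h7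
  rw [h5, ← h7, one_smul]

end Chain

/-! ### The map `phiMap` -/

section Phi

variable {n K : ℕ}

/-- A finite sequence of parameters, continued by zero. -/
noncomputable def extendZero (x : ParamSpace n K) : ℕ → UnitriCoord n × SymCoord n :=
  fun k => if h : k < K then x ⟨k, h⟩ else 0

theorem extendZero_apply (x : ParamSpace n K) (k : Fin K) : extendZero x k = x k := by
  simp [extendZero]

theorem extendZero_update (x : ParamSpace n K) (k : Fin K) (y : UnitriCoord n × SymCoord n) :
    extendZero (Function.update x k y) = Function.update (extendZero x) k y := by
  ext1 i
  by_cases hi : i = k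
  · subst hi; rw [extendZero_apply, Function.update_self, Function.update_self]
  · rw [Function.update_of_ne hi]
    by_cases h : i < K
    · have : (⟨i, h⟩ : Fin K) ≠ k := fun e => hi (by rw [← e])
      simp [extendZero, h, this]
    · simp [extendZero, h]

theorem vecMul_prod_ofFn (X : ℕ → UnitriCoord n × SymCoord n) (m : ℕ) :
    baseRow n ᵥ* (List.ofFn fun k : Fin m => stepMat (stepSign k) (X k)).prod = rowAt X m := by
  induction m with
  | zero => simp [rowAt]
  | succ m ih =>
    rw [List.ofFn_succ', List.concat_eq_append, List.prod_append, ← Matrix.vecMul_vecMul]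
    simp only [Fin.val_castSucc, ih, Fin.val_last, List.prod_singleton]
    rfl

theorem phiMap_eq (x : ParamSpace n K) : phiMap n K x = rowAt (extendZero x) K := by
  rw [phiMap, psiMap, ← vecMul_prod_ofFn]
  congr 3
  ext1 k
  simp [stepMat, stepSign, extendZero_apply]

theorem analyticAt_extendZero (k : ℕ) (x : ParamSpace n K) :
    AnalyticAt ℂ (fun x : ParamSpace n K => extendZero x k) x := by
  by_cases h : k < K
  · simp only [extendZero, h, dite_true]
    exact analyticAt_pi_iff.1 (analyticAt_id (𝕜 := ℂ)) _
  · simp only [extendZero, h, dite_false]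
    exact analyticAt_const

theorem analyticAt_rowAt (m : ℕ) (x : ParamSpace n K) (l : Fin n ⊕ Fin n) :
    AnalyticAt ℂ (fun x : ParamSpace n K => rowAt (extendZero x) m l) x := by
  induction m generalizing l with
  | zero => exact analyticAt_const
  | succ m ih => exact EntryAnalytic.vecMul ih (EntryAnalytic.stepMat _ (analyticAt_extendZero m x)) l

theorem analyticAt_phiMap (x : ParamSpace n K) : AnalyticAt ℂ (phiMap n K) x := by
  rw [funext phiMap_eq]
  exact analyticAt_pi_iff.2 fun l => analyticAt_rowAt K x l

theorem mem_singSet_iff [NeZero n] (hK : 3 ≤ K) (x : ParamSpace n K) :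
    x ∈ singSet n K ↔
      baseRow n ᵥ* stepMat (stepSign 0) (extendZero x 0) = baseRow n ∧
      ∀ k, 0 < k → k + 1 < K →
        baseRow n ᵥ* stepMat (stepSign k) (extendZero x k) = baseRow n ∧
        stepMat (stepSign k) (extendZero x k) *ᵥ baseRow n = baseRow n := by
  have h0 : stepSign 0 = true := by simp [stepSign]
  simp only [stepMat_fix_iff, h0, lastVec_vecMul_stepMat_true_iff]
  constructor
  · rintro ⟨h1, h2⟩
    have h3 : ∀ k, k + 1 < K → symMatrix (extendZero x k).2 *ᵥ lastVec n = 0 := fun k hk => by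
      have := h1 ⟨k, by omega⟩ hk
      rwa [← extendZero_apply x] at this
    refine ⟨h3 0 (by omega), fun k hk0 hk => ⟨h3 k hk, ?_⟩⟩
    have := h2 ⟨k, by omega⟩ hk0 hk
    rwa [← extendZero_apply x] at this
  · rintro ⟨h1, h2⟩
    refine ⟨fun k hk => ?_, fun k hk0 hk => ?_⟩
    · rw [← extendZero_apply x]
      rcases Nat.eq_zero_or_pos (k : ℕ) with h | h
      · rw [h]; exact h1
      · exact (h2 k h hk).1
    · rw [← extendZero_apply x]; exact (h2 k hk0 hk).2

theorem isClosed_singSet : IsClosed (singSet n K) := by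
  have hs : ∀ k : Fin K, Continuous fun x : ParamSpace n K => symMatrix (x k).2 *ᵥ lastVec n := by
    intro k
    refine Continuous.matrix_mulVec (continuous_matrix fun i j => ?_) continuous_const
    simp only [symMatrix, Matrix.of_apply]
    exact (continuous_apply s(i, j)).comp (continuous_snd.comp (continuous_apply k))
  have ht : ∀ k : Fin K,
      Continuous fun x : ParamSpace n K => unitriMatrix (x k).1 *ᵥ lastVec n := by
    intro k
    refine Continuous.matrix_mulVec (continuous_matrix fun i j => ?_) continuous_const
    by_cases h : i < j
    · simp only [unitriMatrix, Matrix.of_apply, h, dite_true]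
      exact (continuous_apply _).comp (continuous_fst.comp (continuous_apply k))
    · simp only [unitriMatrix, Matrix.of_apply, h, dite_false]
      exact continuous_const
  simp only [singSet, Set.ofPred_and, Set.ofPred_forall]
  exact IsClosed.inter
    (isClosed_iInter fun k => isClosed_iInter fun _ => isClosed_eq (hs k) continuous_const)
    (isClosed_iInter fun k => isClosed_iInter fun _ => isClosed_iInter fun _ =>
      isClosed_eq (ht k) continuous_const)

/-- The differential of `phiMap` is onto outside of `singSet`. -/
theorem surjective_fderiv_phiMap [NeZero n] (hK : 3 ≤ K) {z : ParamSpace n K}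
    (hz : z ∉ singSet n K) : Function.Surjective (fderiv ℂ (phiMap n K) z) := by
  by_contra hcon
  have hrange : LinearMap.range (fderiv ℂ (phiMap n K) z).toLinearMap ≠ ⊤ := fun h =>
    hcon (LinearMap.range_eq_top.1 h)
  -- A proper image is annihilated by a nonzero functional, represented by the column c below.
  obtain ⟨f, hf0, hf⟩ := Submodule.exists_le_ker_of_lt_top _ (lt_top_iff_ne_top.2 hrange)
  set c : Fin n ⊕ Fin n → ℂ := fun l => f (Pi.single l 1) with hcdef
  have hfc : ∀ v, f v = v ⬝ᵥ c := by
    intro v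
    conv_lhs => rw [pi_eq_sum_univ' v]
    rw [map_sum]
    simp [dotProduct, hcdef, map_smul]
  have hc : c ≠ 0 := by
    intro h
    exact hf0 (LinearMap.ext fun v => by rw [hfc, h, dotProduct_zero]; rfl)
  have hzero : HasFDerivAt (fun x => phiMap n K x ⬝ᵥ c) (0 : ParamSpace n K →L[ℂ] ℂ) z := by
    have h1 : HasFDerivAt (phiMap n K) (fderiv ℂ (phiMap n K) z) z :=
      (analyticAt_phiMap z).differentiableAt.hasFDerivAt
    have h2 := (LinearMap.toContinuousLinearMap f).hasFDerivAt.comp z h1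
    have h3 : (LinearMap.toContinuousLinearMap f) ∘ phiMap n K = fun x => phiMap n K x ⬝ᵥ c :=
      funext fun x => hfc _
    rw [h3] at h2
    refine h2.congr_fderiv (ContinuousLinearMap.ext fun δ => ?_)
    exact LinearMap.mem_ker.1 (hf ⟨δ, rfl⟩)
  have hblock : ∀ k j, k + 1 + j = K → HasFDerivAt (fun y => (rowAt (extendZero z) k ᵥ*
      stepMat (stepSign k) y) ⬝ᵥ colAt (extendZero z) c j (k + 1)) (0 : _ →L[ℂ] ℂ)
      (extendZero z k) := by
    intro k j hkj
    have hkK : k < K := by omega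
    let k' : Fin K := ⟨k, hkK⟩
    have h1 : HasFDerivAt (Function.update z k') _ (z k') := hasFDerivAt_update (𝕜 := ℂ) z (z k')
    have h2 := HasFDerivAt.comp (z k') (by rw [Function.update_eq_self]; exact hzero) h1
    have h3 : ((fun x => phiMap n K x ⬝ᵥ c) ∘ Function.update z k') =
        fun y => (rowAt (extendZero z) k ᵥ* stepMat (stepSign k) y) ⬝ᵥ
          colAt (extendZero z) c j (k + 1) := by
      ext y
      rw [Function.comp_apply, phiMap_eq, extendZero_update, ← rowAt_update_dotProduct, hkj]
    rw [h3, ContinuousLinearMap.zero_comp, ← extendZero_apply z] at h2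
    exact h2
  refine hz ((mem_singSet_iff hK z).2 ⟨?_, fun k hk0 hk => fix_of_critical hc hblock k hk0 hk⟩)
  have h := (rowAt_eq_of_critical hc hblock 0 (K - 2) (by omega)).1
  rwa [rowAt, rowAt] at h

theorem isHolomorphicSubmersion_phiMap [NeZero n] (hK : 3 ≤ K) :
    IsHolomorphicSubmersion (phiMap n K) (singSet n K)ᶜ ({0}ᶜ : Set (Fin n ⊕ Fin n → ℂ)) := by
  refine isHolomorphicSubmersion_of_surjective_fderiv isClosed_singSet.isOpen_compl
    isOpen_compl_singleton (fun x _ => ?_) (fun x _ => analyticAt_phiMap x)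
    fun z hz => surjective_fderiv_phiMap hK hz
  rw [phiMap_eq]
  exact rowAt_ne_zero _ _

/-- The coordinate vectors of the parameter space. -/
def paramDir (i : Fin K × ({p : Fin n × Fin n // p.1 < p.2} ⊕ Sym2 (Fin n))) : ParamSpace n K :=
  Pi.single i.1 (blockDir i.2)

theorem add_smul_paramDir (x : ParamSpace n K) (t : ℂ)
    (i : Fin K × ({p : Fin n × Fin n // p.1 < p.2} ⊕ Sym2 (Fin n))) :
    x + t • paramDir i = Function.update x i.1 (x i.1 + t • blockDir i.2) := by
  ext1 k
  by_cases hk : k = i.1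
  · subst hk; simp [paramDir]
  · simp [paramDir, hk]

theorem span_range_paramDir :
    Submodule.span ℂ (Set.range (paramDir (n := n) (K := K))) = ⊤ := by
  rw [eq_top_iff]
  intro x _
  rw [← Finset.univ_sum_single x]
  refine Submodule.sum_mem _ fun k _ => ?_
  have h : x k ∈ Submodule.span ℂ (Set.range (blockDir (n := n))) :=
    span_range_blockDir ▸ Submodule.mem_top
  have h2 := Submodule.mem_map_of_mem
    (f := LinearMap.single ℂ (fun _ : Fin K => UnitriCoord n × SymCoord n) k) h
  rw [Submodule.map_span] at h2
  refine Submodule.span_mono ?_ h2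
  rintro _ ⟨_, ⟨b, rfl⟩, rfl⟩
  exact ⟨(k, b), rfl⟩

/-- The coordinates of the rows are multi-affine. -/
theorem affineAlong_rowAt (m : ℕ) (d : Fin n ⊕ Fin n)
    (i : Fin K × ({p : Fin n × Fin n // p.1 < p.2} ⊕ Sym2 (Fin n))) :
    AffineAlong (fun x : ParamSpace n K => rowAt (extendZero x) m d) (paramDir i) := by
  intro x t
  have h1 : x + paramDir i = Function.update x i.1 (x i.1 + blockDir i.2) := by
    simpa using add_smul_paramDir x 1 i
  rw [add_smul_paramDir, h1]
  beta_reduce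
  rcases lt_or_ge (i.1 : ℕ) m with h | h
  -- The row is linear in this single factor, which is affine in each of its coordinates. In the
  -- other case the factor does not enter the row.
  · obtain ⟨j, rfl⟩ : ∃ j, m = i.1 + 1 + j := ⟨m - (i.1 + 1), by omega⟩
    have hval : ∀ y, rowAt (extendZero (Function.update x i.1 y)) (i.1 + 1 + j) d =
        (rowAt (extendZero x) i.1 ᵥ* stepMat (stepSign i.1) y) ⬝ᵥ
          colAt (extendZero x) (Pi.single d 1) j (i.1 + 1) := fun y => by
      rw [extendZero_update, ← rowAt_update_dotProduct, dotProduct_single, mul_one]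
    have hx := hval (x i.1)
    rw [Function.update_eq_self] at hx
    rw [hval, hval, hx, stepMat_add_smul, Matrix.vecMul_add, Matrix.vecMul_smul, Matrix.vecMul_sub,
      add_dotProduct, smul_dotProduct, sub_dotProduct, smul_eq_mul]
  · have hval : ∀ y, rowAt (extendZero (Function.update x i.1 y)) m = rowAt (extendZero x) m :=
      fun y => by
        rw [extendZero_update]
        exact rowAt_congr fun a ha => Function.update_of_ne (by omega) _ _
    rw [hval, hval, sub_self, mul_zero, add_zero]

end Phi

/-! ### The retraction onto the fibres -/

section Retraction

variable {n m : ℕ}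

/-- The last factor but one, changed so that the row behind it vanishes in front of the pivot. -/
noncomputable def adjustPrev (d : Fin n ⊕ Fin n) (v : Fin n ⊕ Fin n → ℂ)
    (x : ParamSpace n (m + 2)) : UnitriCoord n × SymCoord n :=
  stepAdjust (stepSign m) d (v d) (rowAt (extendZero x) (m + 1)) 0 (extendZero x m)

/-- The row in front of the last factor after this change. -/
noncomputable def adjustRow (d : Fin n ⊕ Fin n) (v : Fin n ⊕ Fin n → ℂ)
    (x : ParamSpace n (m + 2)) : Fin n ⊕ Fin n → ℂ :=
  rowAt (extendZero x) m ᵥ* stepMat (stepSign m) (adjustPrev d v x)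

/-- The last factor, changed so that the final row is `v`. -/
noncomputable def adjustLast (d : Fin n ⊕ Fin n) (v : Fin n ⊕ Fin n → ℂ)
    (x : ParamSpace n (m + 2)) : UnitriCoord n × SymCoord n :=
  stepAdjust (stepSign (m + 1)) d (v d)
    (adjustRow d v x ᵥ* stepMat (stepSign (m + 1)) (extendZero x (m + 1))) v
    (extendZero x (m + 1))

/-- The retraction of a level set of the pivot coordinate onto the fibre over `v`. -/
noncomputable def fiberRetract (d : Fin n ⊕ Fin n) (v : Fin n ⊕ Fin n → ℂ)
    (x : ParamSpace n (m + 2)) : ParamSpace n (m + 2) :=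
  Function.update (Function.update x ⟨m, by omega⟩ (adjustPrev d v x)) ⟨m + 1, by omega⟩
    (adjustLast d v x)

theorem extendZero_fiberRetract (d : Fin n ⊕ Fin n) (v : Fin n ⊕ Fin n → ℂ)
    (x : ParamSpace n (m + 2)) : extendZero (fiberRetract d v x) =
      Function.update (Function.update (extendZero x) m (adjustPrev d v x)) (m + 1)
        (adjustLast d v x) := by
  rw [fiberRetract, extendZero_update, extendZero_update]

theorem extendZero_fiberRetract_of_lt (d : Fin n ⊕ Fin n) (v : Fin n ⊕ Fin n → ℂ)
    (x : ParamSpace n (m + 2)) {k : ℕ} (hk : k < m) :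
    extendZero (fiberRetract d v x) k = extendZero x k := by
  rw [extendZero_fiberRetract, Function.update_of_ne (by omega), Function.update_of_ne (by omega)]

theorem extendZero_fiberRetract_prev (d : Fin n ⊕ Fin n) (v : Fin n ⊕ Fin n → ℂ)
    (x : ParamSpace n (m + 2)) : extendZero (fiberRetract d v x) m = adjustPrev d v x := by
  rw [extendZero_fiberRetract, Function.update_of_ne (by omega), Function.update_self]

theorem rowAt_fiberRetract (d : Fin n ⊕ Fin n) (v : Fin n ⊕ Fin n → ℂ)
    (x : ParamSpace n (m + 2)) :
    rowAt (extendZero (fiberRetract d v x)) (m + 1) = adjustRow d v x := by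
  rw [rowAt, rowAt_congr fun k hk => extendZero_fiberRetract_of_lt d v x hk,
    extendZero_fiberRetract_prev, adjustRow]

theorem phiMap_fiberRetract (d : Fin n ⊕ Fin n) (v : Fin n ⊕ Fin n → ℂ)
    (x : ParamSpace n (m + 2)) : phiMap n (m + 2) (fiberRetract d v x) =
      adjustRow d v x ᵥ* stepMat (stepSign (m + 1)) (adjustLast d v x) := by
  rw [phiMap_eq, rowAt, rowAt_fiberRetract, extendZero_fiberRetract, Function.update_self]

theorem adjustRow_pivot (d : Fin n ⊕ Fin n) (v : Fin n ⊕ Fin n → ℂ) (x : ParamSpace n (m + 2)) :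
    adjustRow d v x d = rowAt (extendZero x) (m + 1) d :=
  vecMul_stepAdjust_pivot _ _ _ _ _ _ _

section

variable {d : Fin n ⊕ Fin n} {v : Fin n ⊕ Fin n → ℂ}

theorem adjustRow_eq_zero (hd : v d ≠ 0) {x : ParamSpace n (m + 2)}
    (hx : rowAt (extendZero x) (m + 1) d = v d) {l : Fin n ⊕ Fin n}
    (hl : signRank (stepSign (m + 1)) l < signRank (stepSign (m + 1)) d) :
    adjustRow d v x l = 0 := by
  -- In front of d for the last sign means behind d for the sign of the last factor but one, where
  -- the correction prescribes the value 0.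
  rw [stepSign_succ, signRank_not_lt_iff] at hl
  exact vecMul_stepAdjust_of_gt hd 0 rfl hx hl

/-- The retraction maps the level set of the pivot coordinate into the fibre. -/
theorem phiMap_fiberRetract_eq (hd : v d ≠ 0)
    (hv : ∀ l, signRank (stepSign (m + 1)) l < signRank (stepSign (m + 1)) d → v l = 0)
    {x : ParamSpace n (m + 2)} (hx : rowAt (extendZero x) (m + 1) d = v d) :
    phiMap n (m + 2) (fiberRetract d v x) = v := by
  have hzero := fun l => adjustRow_eq_zero (l := l) hd hx
  have hpiv : adjustRow d v x d = v d := (adjustRow_pivot d v x).trans hx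
  rw [phiMap_fiberRetract]
  ext l
  rcases lt_trichotomy (signRank (stepSign (m + 1)) l) (signRank (stepSign (m + 1)) d) with h | h | h
  · rw [vecMul_stepMat_eq_zero _ hzero h, hv l h]
  · rw [signRank_injective _ h, vecMul_stepMat_pivot _ hzero, hpiv]
  · exact vecMul_stepAdjust_of_gt hd v rfl ((vecMul_stepMat_pivot _ hzero).trans hpiv) h

theorem rowAt_eq_vecMul_stepInv (x : ParamSpace n (m + 2)) :
    rowAt (extendZero x) (m + 1) =
      phiMap n (m + 2) x ᵥ* stepInv (stepSign (m + 1)) (extendZero x (m + 1)) := by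
  rw [phiMap_eq, rowAt.eq_2 _ (m + 1), Matrix.vecMul_vecMul, stepMat_mul_stepInv,
    Matrix.vecMul_one]

/-- The inverse of the last factor is unitriangular too, so it does not change the first nonzero
coordinate. The fibre therefore lies in a level set of the pivot coordinate. -/
theorem rowAt_pivot_of_phiMap_eq
    (hv : ∀ l, signRank (stepSign (m + 1)) l < signRank (stepSign (m + 1)) d → v l = 0)
    {x : ParamSpace n (m + 2)} (hx : phiMap n (m + 2) x = v) :
    rowAt (extendZero x) (m + 1) d = v d := by
  rw [rowAt_eq_vecMul_stepInv, hx, vecMul_stepInv_pivot _ hv]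

/-- The retraction fixes the points of the fibre. -/
theorem fiberRetract_eq_self
    (hv : ∀ l, signRank (stepSign (m + 1)) l < signRank (stepSign (m + 1)) d → v l = 0)
    {x : ParamSpace n (m + 2)} (hx : phiMap n (m + 2) x = v) :
    fiberRetract d v x = x := by
  have h1 : adjustPrev d v x = extendZero x m := by
    refine stepAdjust_self _ fun l hl => ?_
    rw [← signRank_not_lt_iff, ← stepSign_succ] at hl
    rw [rowAt_eq_vecMul_stepInv, hx, vecMul_stepInv_eq_zero _ hv hl]
    rfl
  have h2 : adjustLast d v x = extendZero x (m + 1) := by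
    refine stepAdjust_self _ fun l _ => ?_
    rw [adjustRow, h1, ← hx, phiMap_eq]
    rfl
  have e1 : extendZero x m = x ⟨m, by omega⟩ := extendZero_apply x ⟨m, by omega⟩
  have e2 : extendZero x (m + 1) = x ⟨m + 1, by omega⟩ := extendZero_apply x ⟨m + 1, by omega⟩
  rw [fiberRetract, h1, h2, e1, e2, Function.update_eq_self, Function.update_eq_self]

theorem analyticAt_update {G H : Type*} [NormedAddCommGroup G] [NormedSpace ℂ G]
    [NormedAddCommGroup H] [NormedSpace ℂ H] {κ : Type*} [Fintype κ] [DecidableEq κ]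
    {f : G → κ → H} {g : G → H} {x : G} (k : κ) (hf : AnalyticAt ℂ f x) (hg : AnalyticAt ℂ g x) :
    AnalyticAt ℂ (fun y => Function.update (f y) k (g y)) x := by
  refine analyticAt_pi_iff.2 fun j => ?_
  by_cases h : j = k
  · subst h; simpa only [Function.update_self] using hg
  · simpa only [Function.update_of_ne h] using analyticAt_pi_iff.1 hf j

/-- The only divisions are by v d, never by a coordinate depending on x, so the retraction is
holomorphic in x on the whole parameter space, also off the level set. -/
theorem analyticAt_fiberRetract (hd : v d ≠ 0) (x : ParamSpace n (m + 2)) :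
    AnalyticAt ℂ (fun p : (Fin n ⊕ Fin n → ℂ) × ParamSpace n (m + 2) => fiberRetract d p.1 p.2)
      (v, x) := by
  have hv : ∀ l, AnalyticAt ℂ
      (fun p : (Fin n ⊕ Fin n → ℂ) × ParamSpace n (m + 2) => p.1 l) (v, x) := fun l =>
    analyticAt_pi_iff.1 analyticAt_fst l
  have hrow : ∀ k l, AnalyticAt ℂ (fun p : (Fin n ⊕ Fin n → ℂ) × ParamSpace n (m + 2) =>
      rowAt (extendZero p.2) k l) (v, x) := fun k l =>
    AnalyticAt.fun_comp (g := fun x : ParamSpace n (m + 2) => rowAt (extendZero x) k l)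
      (analyticAt_rowAt k x l) analyticAt_snd
  have hext : ∀ k, AnalyticAt ℂ (fun p : (Fin n ⊕ Fin n → ℂ) × ParamSpace n (m + 2) =>
      extendZero p.2 k) (v, x) := fun k =>
    AnalyticAt.fun_comp (g := fun x : ParamSpace n (m + 2) => extendZero x k)
      (analyticAt_extendZero k x) analyticAt_snd
  have hprev : AnalyticAt ℂ (fun p : (Fin n ⊕ Fin n → ℂ) × ParamSpace n (m + 2) =>
      adjustPrev d p.1 p.2) (v, x) :=
    analyticAt_stepAdjust _ d (hv d) hd (hrow (m + 1)) (fun _ => analyticAt_const) (hext m)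
  have hadj : ∀ l, AnalyticAt ℂ (fun p : (Fin n ⊕ Fin n → ℂ) × ParamSpace n (m + 2) =>
      adjustRow d p.1 p.2 l) (v, x) := fun l =>
    EntryAnalytic.vecMul (hrow m) (EntryAnalytic.stepMat _ hprev) l
  have hlast : AnalyticAt ℂ (fun p : (Fin n ⊕ Fin n → ℂ) × ParamSpace n (m + 2) =>
      adjustLast d p.1 p.2) (v, x) :=
    analyticAt_stepAdjust _ d (hv d) hd
      (fun l => EntryAnalytic.vecMul hadj (EntryAnalytic.stepMat _ (hext (m + 1))) l) hv
      (hext (m + 1))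
  exact analyticAt_update _ (analyticAt_update _ analyticAt_snd hprev) hlast

/-- The pivot coordinate has no critical points on the fibre outside of `singSet`. -/
theorem exists_diffAlong_ne_zero [NeZero n] (hm : 1 ≤ m)
    (hv : ∀ l, signRank (stepSign (m + 1)) l < signRank (stepSign (m + 1)) d → v l = 0)
    {z : ParamSpace n (m + 2)} (hz : z ∉ singSet n (m + 2)) (hzv : phiMap n (m + 2) z = v) :
    ∃ i, diffAlong (fun x : ParamSpace n (m + 2) => rowAt (extendZero x) (m + 1) d)
      (paramDir i) z ≠ 0 := by
  by_contra! hcon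
  set Q : ParamSpace n (m + 2) → ℂ := fun x => rowAt (extendZero x) (m + 1) d
  have hQd : DifferentiableAt ℂ Q z := (analyticAt_rowAt (m + 1) z d).differentiableAt
  have hQ0 : fderiv ℂ Q z = 0 := by
    have h : (fderiv ℂ Q z).toLinearMap = 0 := by
      refine LinearMap.ext_on_range span_range_paramDir fun i => ?_
      exact ((affineAlong_rowAt (m + 1) d i).fderiv_apply hQd).trans (hcon i)
    exact ContinuousLinearMap.coe_injective h
  let N : ParamSpace n (m + 2) → Fin n ⊕ Fin n → ℂ := fun x l =>
    stepInv (stepSign (m + 1)) (extendZero x (m + 1)) l d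
  have hN : ∀ l, DifferentiableAt ℂ (fun x => N x l) z := fun l =>
    (EntryAnalytic.stepInv _ (analyticAt_extendZero (m + 1) z) l d).differentiableAt
  have hP : ∀ l, HasFDerivAt (fun x => phiMap n (m + 2) x l)
      ((ContinuousLinearMap.proj l).comp (fderiv ℂ (phiMap n (m + 2)) z)) z := fun l =>
    (ContinuousLinearMap.proj (R := ℂ) (φ := fun _ : Fin n ⊕ Fin n => ℂ) l).hasFDerivAt.comp z
      (analyticAt_phiMap z).differentiableAt.hasFDerivAt
  -- N is column d of the inverse of the last factor, and v pairs with it to v d for every x by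
  -- triangularity. Hence at z, where Φ = v, the derivatives of N drop out and dQ = ∑ N l dΦ l.
  have hQN : Q = fun x => v d + ∑ l, (phiMap n (m + 2) x l - v l) * N x l := by
    ext x
    have h1 : Q x = ∑ l, phiMap n (m + 2) x l * N x l := by
      change rowAt (extendZero x) (m + 1) d = _
      rw [rowAt_eq_vecMul_stepInv]
      rfl
    have h2 : v d = ∑ l, v l * N x l :=
      (vecMul_stepInv_pivot (extendZero x (m + 1)) hv).symm
    rw [h1, h2, ← Finset.sum_add_distrib]
    exact Finset.sum_congr rfl fun l _ => by ring
  have hder : HasFDerivAt Q (∑ l, ((phiMap n (m + 2) z l - v l) • fderiv ℂ (fun x => N x l) z +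
      N z l • (ContinuousLinearMap.proj l).comp (fderiv ℂ (phiMap n (m + 2)) z))) z := by
    rw [hQN]
    exact (HasFDerivAt.fun_sum fun l _ =>
      ((hP l).sub_const (v l)).mul (hN l).hasFDerivAt).const_add (v d)
  -- A direction chosen so that dΦ(δ), multiplied by the inverse of the last factor, is the basis
  -- row at d; the formula for dQ then gives dQ(δ) = 1.
  obtain ⟨δ, hδ⟩ := surjective_fderiv_phiMap (by omega) hz
    ((Pi.single d 1 : Fin n ⊕ Fin n → ℂ) ᵥ* stepMat (stepSign (m + 1)) (extendZero z (m + 1)))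
  have h1 := DFunLike.congr_fun hder.fderiv δ
  rw [hQ0] at h1
  have h2 : (((Pi.single d 1 : Fin n ⊕ Fin n → ℂ) ᵥ*
      stepMat (stepSign (m + 1)) (extendZero z (m + 1))) ᵥ*
      stepInv (stepSign (m + 1)) (extendZero z (m + 1))) d = 1 := by
    rw [Matrix.vecMul_vecMul, stepMat_mul_stepInv, Matrix.vecMul_one, Pi.single_eq_same]
  rw [← hδ] at h2
  have h3 : ((fderiv ℂ (phiMap n (m + 2)) z δ) ᵥ*
      stepInv (stepSign (m + 1)) (extendZero z (m + 1))) d = 0 := by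
    rw [zero_apply] at h1
    rw [h1, sum_apply, Matrix.vecMul, dotProduct]
    refine Finset.sum_congr rfl fun l _ => ?_
    simp [hzv, N, mul_comm]
  rw [h3] at h2
  exact zero_ne_one h2

/-- The retraction maps non-critical points of the pivot coordinate out of `singSet`. -/
theorem fiberRetract_notMem_singSet [NeZero n] (hm : 1 ≤ m) (hd : v d ≠ 0)
    {x : ParamSpace n (m + 2)} (hx : rowAt (extendZero x) (m + 1) d = v d)
    (hne : ∃ i, diffAlong (fun x : ParamSpace n (m + 2) => rowAt (extendZero x) (m + 1) d)
      (paramDir i) x ≠ 0) : fiberRetract d v x ∉ singSet n (m + 2) := by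
  intro hmem
  obtain ⟨h0, hfix⟩ := (mem_singSet_iff (by omega) _).1 hmem
  have hrow' : ∀ k, k ≤ m + 1 → rowAt (extendZero (fiberRetract d v x)) k = baseRow n := by
    intro k
    induction k with
    | zero => exact fun _ => rfl
    | succ k ih =>
      intro hk
      rw [rowAt, ih (by omega)]
      rcases Nat.eq_zero_or_pos k with rfl | hk0
      · exact h0
      · exact (hfix k hk0 (by omega)).1
  have hrow : ∀ k, k ≤ m → rowAt (extendZero x) k = baseRow n := fun k hk => by
    rw [← hrow' k (by omega)]
    exact rowAt_congr fun i hi => (extendZero_fiberRetract_of_lt d v x (by omega)).symm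
  -- On `singSet` the row in front of the last factor is the last basis row, while its coordinate d
  -- equals v d ≠ 0.
  have hdl : d = Sum.inr (lastIdx n) := by
    by_contra hcon
    have h1 := (adjustRow_pivot d v x).trans hx
    rw [← rowAt_fiberRetract, hrow' _ le_rfl, baseRow_eq, Pi.single_eq_of_ne hcon] at h1
    exact hd h1.symm
  have hbase : (Pi.single d 1 : Fin n ⊕ Fin n → ℂ) = baseRow n := by rw [hdl, baseRow_eq]
  have hdot : ∀ u, u ⬝ᵥ baseRow n = u d := fun u => by
    rw [← hbase, dotProduct_single, mul_one]
  -- The correction of factor m fixes the column at d, which is now the last basis vector. So the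
  -- original factor fixes that column as well.
  have hcol1 : ∀ k, 0 < k → k ≤ m →
      stepMat (stepSign k) (extendZero x k) *ᵥ baseRow n = baseRow n := by
    intro k hk0 hk
    have h1 := (hfix k hk0 (by omega)).2
    rcases hk.lt_or_eq with h | rfl
    · rwa [extendZero_fiberRetract_of_lt d v x h] at h1
    · rw [extendZero_fiberRetract_prev, ← hbase, adjustPrev, stepMat_stepAdjust_mulVec_single] at h1
      rwa [← hbase]
  have hcol : ∀ j k, 0 < k → k + j = m + 1 → colAt (extendZero x) (baseRow n) j k = baseRow n := by
    intro j
    induction j with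
    | zero => exact fun _ _ _ => rfl
    | succ j ih =>
      intro k hk0 hk
      rw [colAt, ih (k + 1) (by omega) (by omega), hcol1 k hk0 (by omega)]
  -- With basis rows in front of a factor and basis columns behind it, replacing that factor alone
  -- leaves the pivot coordinate equal to 1. Factor m + 1 does not enter it. All differences of the
  -- pivot coordinate at x therefore vanish.
  have hconst : ∀ (k : Fin (m + 2)) y,
      rowAt (extendZero (Function.update x k y)) (m + 1) d = rowAt (extendZero x) (m + 1) d := by
    intro k y
    rcases (Nat.lt_succ_iff.1 k.2).lt_or_eq with h | h
    · obtain ⟨j, hj⟩ : ∃ j, m + 1 = k + 1 + j := ⟨m - k, by omega⟩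
      have hval : ∀ y, rowAt (extendZero (Function.update x k y)) (m + 1) d = 1 := fun y => by
        have h1 := rowAt_update_dotProduct (extendZero x) (baseRow n) k j y
        rw [hcol j (k + 1) (by omega) hj.symm, hrow k (by omega), ← hj, ← extendZero_update] at h1
        rw [hdot, hdot] at h1
        rw [h1, hdl]
        exact lastVec_vecMul_stepMat_apply _ _
      have h2 := hval (x k)
      rw [Function.update_eq_self] at h2
      rw [hval, h2]
    · rw [extendZero_update]
      rw [rowAt_congr (X' := extendZero x) fun a ha => Function.update_of_ne (by omega) _ _]
  obtain ⟨i, hi⟩ := hne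
  refine hi ?_
  have h1 : x + paramDir i = Function.update x i.1 (x i.1 + blockDir i.2) := by
    simpa using add_smul_paramDir x 1 i
  rw [diffAlong, h1, hconst, sub_self]

end

theorem unitriMatrix_zero : unitriMatrix (0 : UnitriCoord n) = 1 := by
  have h : triCoord (1 : Matrix (Fin n) (Fin n) ℂ) = 0 := by
    ext ⟨p, hp⟩
    exact Matrix.one_apply_ne hp.ne
  rw [← h, unitriMatrix_triCoord isUnitri_one]

theorem stepMat_zero (s : Bool) : stepMat s (0 : UnitriCoord n × SymCoord n) = 1 := by
  have h1 := unitriMatrix_zero (n := n)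
  have h2 : symMatrix (0 : SymCoord n) = 0 := rfl
  cases s
  · change elemPlus _ _ = 1
    simp [h1, h2, elemPlus_eq]
  · change elemMinus _ _ = 1
    simp [h1, h2, elemMinus_eq]

/-- A nonzero value of a coordinate of the row behind all factors but the last is attained at a
point whose first factor moves the last basis vector. -/
theorem exists_rowAt_eq [NeZero n] (hm : 1 ≤ m) (d : Fin n ⊕ Fin n) {c : ℂ} (hc : c ≠ 0) :
    ∃ x : ParamSpace n (m + 2), rowAt (extendZero x) (m + 1) d = c ∧
      baseRow n ᵥ* stepMat (stepSign 0) (extendZero x 0) ≠ baseRow n := by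
  have hs0 : stepSign 0 = true := by simp [stepSign]
  have hs1 : stepSign 1 = false := by simp [stepSign]
  have hU := unitriMatrix_zero (n := n)
  have key : ∀ (i : Fin n) (a b : ℂ), a ≠ 0 → ∃ x : ParamSpace n (m + 2),
      rowAt (extendZero x) (m + 1) = Sum.elim (Pi.single i a) (lastVec n + Pi.single i (a * b)) ∧
      baseRow n ᵥ* stepMat (stepSign 0) (extendZero x 0) ≠ baseRow n := by
    -- The first factor puts a at position i of the first half, the second adds a b at position i of
    -- the second half, and all later factors are trivial.
    intro i a b ha
    let x : ParamSpace n (m + 2) := fun k =>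
      if (k : ℕ) = 0 then (0, Pi.single s(i, lastIdx n) a)
      else if (k : ℕ) = 1 then (0, Pi.single s(i, i) b) else 0
    have hx0 : extendZero x 0 = (0, Pi.single s(i, lastIdx n) a) := by simp [extendZero, x]
    have hx1 : extendZero x 1 = (0, Pi.single s(i, i) b) := by simp [extendZero, x]
    have hxk : ∀ k, 2 ≤ k → extendZero x k = 0 := by
      intro k hk
      by_cases h : k < m + 2
      · have e0 : k ≠ 0 := by omega
        have e1 : k ≠ 1 := by omega
        simp [extendZero, x, h, e0, e1]
      · simp [extendZero, h]
    have hZ0 : symMatrix (Pi.single s(i, lastIdx n) a) *ᵥ lastVec n = Pi.single i a := by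
      rw [lastVec_eq, Matrix.mulVec_single_one]
      ext k
      by_cases hk : k = i
      · subst hk; simp [symMatrix]
      · have : s(k, lastIdx n) ≠ s(i, lastIdx n) := fun e => hk (Sym2.congr_left.1 e)
        simp [symMatrix, hk, this]
    have hZ1 : Pi.single i a ᵥ* symMatrix (Pi.single s(i, i) b) = Pi.single i (a * b) := by
      ext k
      rw [Matrix.single_vecMul]
      by_cases hk : k = i
      · subst hk; simp [symMatrix]
      · have : s(i, k) ≠ s(i, i) := fun e => hk (Sym2.congr_right.1 e)
        simp [symMatrix, hk, this]
    have hr1 : rowAt (extendZero x) 1 = Sum.elim (Pi.single i a) (lastVec n) := by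
      rw [rowAt, rowAt, hs0, hx0]
      change _ ᵥ* elemMinus _ _ = _
      rw [lastVec_vecMul_minus _ _ (isUnitri_unitriMatrix _), lastVec_vecMul_symMatrix, hZ0, hU]
      simp
    have hr2 : rowAt (extendZero x) 2 =
        Sum.elim (Pi.single i a) (lastVec n + Pi.single i (a * b)) := by
      rw [rowAt, hr1, hs1, hx1]
      change _ ᵥ* elemPlus _ _ = _
      rw [elemPlus_eq, hU, Matrix.vecMul_fromBlocks]
      simp [hZ1, add_comm]
    have hrk : ∀ k, rowAt (extendZero x) (k + 2) = rowAt (extendZero x) 2 := by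
      intro k
      induction k with
      | zero => rfl
      | succ k ih => rw [rowAt, hxk _ (by omega), stepMat_zero, Matrix.vecMul_one, ih]
    obtain ⟨k, rfl⟩ : ∃ k, m = k + 1 := ⟨m - 1, by omega⟩
    refine ⟨x, (hrk k).trans hr2, ?_⟩
    rw [hs0, Ne, lastVec_vecMul_stepMat_true_iff, hx0, hZ0]
    intro h
    exact ha (by simpa using congrFun h i)
  -- The first half needs only a = c. In the second half a = 1 and b makes up the difference to the
  -- entry already present.
  rcases d with i | i
  · obtain ⟨x, h1, h2⟩ := key i c 0 hc
    exact ⟨x, by rw [h1]; simp, h2⟩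
  · obtain ⟨x, h1, h2⟩ := key i 1 (c - lastVec n i) one_ne_zero
    exact ⟨x, by rw [h1]; simp, h2⟩

end Retraction

/-! ### The stratification -/

section Stratification

variable {n : ℕ}

/-- The nonzero rows whose first `2 n - 1 - k` coordinates vanish. -/
def flagSet (s : Bool) (k : ℕ) : Set (Fin n ⊕ Fin n → ℂ) :=
  {v | v ≠ 0 ∧ ∀ l, signRank s l < 2 * n - 1 - k → v l = 0}

/-- Each step of the flag frees exactly one coordinate, and a stratum requires the newly freed one
to be nonzero, so the pivot is constant on it. -/
theorem mem_stratum_flagSet_iff {s : Bool} {k : ℕ} (hk : k ≤ 2 * n - 1)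
    {v : Fin n ⊕ Fin n → ℂ} :
    v ∈ stratum (flagSet s) k ↔ ∃ d, signRank s d = 2 * n - 1 - k ∧ v d ≠ 0 ∧
      ∀ l, signRank s l < signRank s d → v l = 0 := by
  constructor
  · intro h
    cases k with
    | zero =>
      obtain ⟨h1, h2⟩ := h
      obtain ⟨d, hd⟩ := Function.ne_iff.1 h1
      have h3 : ¬signRank s d < 2 * n - 1 - 0 := fun h => hd (h2 d h)
      have h4 := signRank_lt s d
      have h5 : signRank s d = 2 * n - 1 - 0 := by omega
      exact ⟨d, h5, hd, fun l hl => h2 l (h5 ▸ hl)⟩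
    | succ k =>
      obtain ⟨⟨h1, h2⟩, h3⟩ := h
      have h4 : ∃ d, signRank s d < 2 * n - 1 - k ∧ v d ≠ 0 := by
        by_contra! hcon
        exact h3 ⟨h1, hcon⟩
      obtain ⟨d, hd1, hd2⟩ := h4
      have h5 : ¬signRank s d < 2 * n - 1 - (k + 1) := fun h => hd2 (h2 d h)
      have h6 : signRank s d = 2 * n - 1 - (k + 1) := by omega
      exact ⟨d, h6, hd2, fun l hl => h2 l (h6 ▸ hl)⟩
  · rintro ⟨d, h1, h2, h3⟩
    have hne : v ≠ 0 := fun h => h2 (congrFun h d)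
    have hmem : v ∈ flagSet s k := ⟨hne, fun l hl => h3 l (h1.symm ▸ hl)⟩
    cases k with
    | zero => exact hmem
    | succ k =>
      refine ⟨hmem, fun h => h2 (h.2 d ?_)⟩
      omega

/-- The coordinates in a finite set of indices. -/
noncomputable def coordMap (p : Fin n ⊕ Fin n → Prop) [DecidablePred p] :
    (Fin n ⊕ Fin n → ℂ) →L[ℂ] (Fin (Fintype.card {l // p l}) → ℂ) :=
  ContinuousLinearMap.pi fun a => ContinuousLinearMap.proj ((Fintype.equivFin {l // p l}).symm a).1

theorem coordMap_eq_zero_iff (p : Fin n ⊕ Fin n → Prop) [DecidablePred p]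
    (v : Fin n ⊕ Fin n → ℂ) : coordMap p v = 0 ↔ ∀ l, p l → v l = 0 := by
  constructor
  · intro h l hl
    simpa [coordMap] using congrFun h (Fintype.equivFin {l // p l} ⟨l, hl⟩)
  · intro h
    ext a
    exact h _ ((Fintype.equivFin {l // p l}).symm a).2

theorem coordMap_surjective (p : Fin n ⊕ Fin n → Prop) [DecidablePred p] :
    Function.Surjective (coordMap p) := by
  intro w
  refine ⟨fun l => if h : p l then w (Fintype.equivFin {l // p l} ⟨l, h⟩) else 0, ?_⟩
  ext a
  have h := ((Fintype.equivFin {l // p l}).symm a).2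
  simp [coordMap, h]

theorem isClosedComplexSubspace_flagSet (s : Bool) (k : ℕ) :
    IsClosedComplexSubspace (flagSet s k) ({0}ᶜ : Set (Fin n ⊕ Fin n → ℂ)) := by
  refine ⟨fun v hv => hv.1, fun v hv => ⟨{0}ᶜ, _,
    coordMap fun l => signRank s l < 2 * n - 1 - k, isOpen_compl_singleton, hv, subset_rfl,
    fun u _ => (coordMap _).analyticAt u, ?_⟩⟩
  ext u
  constructor
  · rintro ⟨h1, h2⟩
    exact ⟨h2, (coordMap_eq_zero_iff _ _).2 h1.2⟩
  · rintro ⟨h1, h2⟩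
    exact ⟨⟨h1, (coordMap_eq_zero_iff _ _).1 h2⟩, h1⟩

theorem isRegularSubspace_stratum_flagSet (s : Bool) {k : ℕ} (hk : k ≤ 2 * n - 1) :
    IsRegularSubspace (stratum (flagSet (n := n) s) k) := by
  intro v hv
  obtain ⟨d, hd1, hd2, hd3⟩ := (mem_stratum_flagSet_iff hk).1 hv
  refine ⟨{u | u d ≠ 0}, _, coordMap fun l => signRank s l < signRank s d,
    isOpen_ne_fun (continuous_apply d) continuous_const, hd2,
    fun u _ => (coordMap _).analyticAt u, fun u _ => ?_, ?_⟩
  · rw [ContinuousLinearMap.fderiv]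
    exact coordMap_surjective _
  · ext u
    constructor
    · rintro ⟨h1, h2⟩
      obtain ⟨d', h1', -, h3'⟩ := (mem_stratum_flagSet_iff hk).1 h1
      have : d' = d := signRank_injective s (h1'.trans hd1.symm)
      subst this
      exact ⟨h2, (coordMap_eq_zero_iff _ _).2 h3'⟩
    · rintro ⟨h1, h2⟩
      exact ⟨(mem_stratum_flagSet_iff hk).2 ⟨d, hd1, h1, (coordMap_eq_zero_iff _ _).1 h2⟩, h1⟩

end Stratification

/-! ### The stratified elliptic submersion -/

theorem proposition3p3 (n K : ℕ) (hn : 2 ≤ n) (hK : 3 ≤ K) :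
    IsStratifiedEllipticSubmersion (phiMap n K) (singSet n K)ᶜ
      ({0}ᶜ : Set (Fin n ⊕ Fin n → ℂ)) := by
  have : NeZero n := ⟨by omega⟩
  obtain ⟨m, rfl⟩ : ∃ m, K = m + 2 := ⟨K - 2, by omega⟩
  -- K ≥ 3 leaves at least one factor in front of the two that the retraction changes.
  have hm : 1 ≤ m := by omega
  have hsub := isHolomorphicSubmersion_phiMap (n := n) hK
  set s := stepSign (m + 1) with hs
  refine ⟨hsub, ?_, 2 * n - 1, flagSet s, ?_, ?_, fun k _ => isClosedComplexSubspace_flagSet s k,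
    fun k hk => ⟨isRegularSubspace_stratum_flagSet s hk, ?_⟩⟩
  · intro v hv
    obtain ⟨d₀, hd₀⟩ := Function.ne_iff.1 (show v ≠ 0 from hv)
    obtain ⟨d, hd, hmin⟩ := Finset.exists_min_image (Finset.univ.filter fun l => v l ≠ 0)
      (signRank s) ⟨d₀, by simpa using hd₀⟩
    have hd' : v d ≠ 0 := by simpa using hd
    have hv0 : ∀ l, signRank s l < signRank s d → v l = 0 := fun l hl => by
      by_contra hne
      exact absurd (hmin l (by simpa using hne)) (by omega)
    -- The pivot value is attained at a point whose first factor violates the equations of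
    -- `singSet`. The retraction keeps that factor, so the resulting preimage of v lies outside
    -- `singSet`.
    obtain ⟨x, hx, hx0⟩ := exists_rowAt_eq hm d hd'
    refine ⟨fiberRetract d v x, fun hmem => hx0 ?_, phiMap_fiberRetract_eq hd' hv0 hx⟩
    rw [← extendZero_fiberRetract_of_lt d v x (show 0 < m by omega)]
    exact ((mem_singSet_iff hK _).1 hmem).1
  · ext v
    simp [flagSet]
  · intro k hk v hv
    exact ⟨hv.1, fun l hl => hv.2 l (by omega)⟩
  · intro v hv
    obtain ⟨d, hd1, -, -⟩ := (mem_stratum_flagSet_iff hk).1 hv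
    have hstr : ∀ z ∈ (singSet n (m + 2))ᶜ ∩
        phiMap n (m + 2) ⁻¹' (stratum (flagSet s) k ∩ Set.univ),
        phiMap n (m + 2) z d ≠ 0 ∧
          ∀ l, signRank s l < signRank s d → phiMap n (m + 2) z l = 0 := by
      rintro z ⟨-, hz, -⟩
      obtain ⟨d', h1, h2, h3⟩ := (mem_stratum_flagSet_iff hk).1 hz
      have : d' = d := signRank_injective s (h1.trans hd1.symm)
      subst this
      exact ⟨h2, h3⟩
    -- No localization is needed: the pivot is the same on the whole stratum, so one spray serves
    -- all of it.
    refine ⟨Set.univ, isOpen_univ, Set.mem_univ _, ?_⟩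
    refine exists_spray_of_retraction hsub Set.inter_subset_left
      (Q := fun x => rowAt (extendZero x) (m + 1) d) (D := paramDir) (R := fiberRetract d)
      span_range_paramDir (fun x => analyticAt_rowAt (m + 1) x d)
      (fun i => affineAlong_rowAt (m + 1) d i)
      (fun z hz x => analyticAt_fiberRetract (hstr z hz).1 x)
      (fun z hz => exists_diffAlong_ne_zero hm (hstr z hz).2 hz.1 rfl) ?_ ?_
    · intro z hz x hx hne
      have hx' : rowAt (extendZero x) (m + 1) d = phiMap n (m + 2) z d :=
        hx.trans (rowAt_pivot_of_phiMap_eq (hstr z hz).2 rfl)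
      exact ⟨fiberRetract_notMem_singSet hm (hstr z hz).1 hx' hne,
        phiMap_fiberRetract_eq (hstr z hz).1 (hstr z hz).2 hx'⟩
    · intro z hz x _ hxz
      exact ⟨(rowAt_pivot_of_phiMap_eq (hstr z hz).2 hxz).trans
        (rowAt_pivot_of_phiMap_eq (hstr z hz).2 rfl).symm, fiberRetract_eq_self (hstr z hz).2 hxz⟩
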